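/- Let $n\ge 1$ be an integer and $Y:=(0,1)^n$. A function on $\mathbb{R}^n$ is called $Y$-periodic if it is invariant under translations by $\mathbb{Z}^n$. $L^p_{\mathrm{per}}(Y)$ denotes the space of $Y$-periodic functions whose restriction to $Y$ is in $L^p(Y)$; $H^k_{\mathrm{per}}(Y)$ is the space of functions in $L^2_{\mathrm{per}}(Y)$ whose weak derivatives up to order $k$ (with respect to smooth $Y$-periodic test functions) are in $L^2_{\mathrm{per}}(Y)$; and $H^1_{\mathrm{per},0}(Y;\mathbb{R}^n)$ is the space of $w\in H^1_{\mathrm{per}}(Y;\mathbb{R}^n)$ with $\int_Y w=0$. Functions are identified if they agree almost everywhere. We write $M:N=\sum_{i,j}M_{ij}N_{ij}$, $|M|^2=M:M$, and $(Dw)_{ij}=\partial_j w_i$. Let $A\in L^\infty_{\mathrm{per}}(Y;\mathbb{R}^{n\times n}_{\mathrm{sym}})$ and $b\in L^\infty_{\mathrm{per}}(Y;\mathbb{R}^n)$. Suppose that there are $\lambda,\Lambda>0$ with $\lambda I_n\le A\le\Lambda I_n$ a.e. in $\mathbb{R}^n$, and that there is $\delta\in\left(\frac{n}{n+\pi^2},1\right]$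 with $$\frac{|A|^2+|b|^2}{(\mathrm{tr}(A))^2}\le\frac{1}{n-1+\delta}\quad\text{a.e. in }\mathbb{R}^n.$$ Let $F\in L^2_{\mathrm{per}}(Y;\mathbb{R}^n)$, and set $\gamma:=\frac{\mathrm{tr}(A)}{|A|^2+|b|^2}$, $\tilde A:=\gamma A$, $\tilde b:=\gamma b$. For $G\in L^2_{\mathrm{per}}(Y;\mathbb{R}^n)$, a function $u\in L^2_{\mathrm{per}}(Y)$ is called a solution of $$-D^2:(\tilde A u)+\nabla\cdot(\tilde b u)=\nabla\cdot G\quad\text{in }Y,\qquad u\ \ Y\text{-periodic},\tag{$P_G$}$$ if $$\int_Y u\,\tilde A:D^2\varphi+\int_Y u\,\tilde b\cdot\nabla\varphi=\int_Y G\cdot\nabla\varphi\qquad\text{for all }\varphi\in H^2_{\mathrm{per}}(Y).$$ For $v,w\in H^1_{\mathrm{per},0}(Y;\mathbb{R}^n)$ let $$B_2(v,w):=\int_Y(\nabla\cdot v)\left(\tilde A:Dw+\tilde b\cdot w\right)+\frac12\int_Y\left(Dv-(Dv)^{\mathrm T}\right):\left(Dw-(Dw)^{\mathrm T}\right).$$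 There is a unique solution $\tilde r\in L^2_{\mathrm{per}}(Y)$ of $(P_0)$ with $\int_Y\tilde r=1$, and the following assertions hold. (i) There exists a unique $\tilde\rho_0\in H^1_{\mathrm{per},0}(Y;\mathbb{R}^n)$ such that $B_2(\tilde\rho_0,w)=-\int_Y F\cdot w$ for all $w\in H^1_{\mathrm{per},0}(Y;\mathbb{R}^n)$. (ii) The function $\tilde u_0:=-\nabla\cdot\tilde\rho_0$ is the unique solution in $L^2_{\mathrm{per}}(Y)$ of $(P_F)$ with $\int_Y\tilde u_0=0$. (iii) A function $\tilde u\in L^2_{\mathrm{per}}(Y)$ is a solution of $(P_F)$ if and only if $\tilde u=\tilde u_0+c\,\tilde r$ for some constant $c\in\mathbb{R}$. -/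

import Mathlib

open MeasureTheory Matrix
open scoped ContDiff

namespace CordesFPK

/-- The unit cell `Y = (0,1)^n`. Points of `ℝ^n` are written as `Fin n → ℝ`; the norm of this type
is never used, only its Lebesgue measure and its smooth structure. -/
def unitCell (n : ℕ) : Set (Fin n → ℝ) := Set.univ.pi fun _ => Set.Ioo (0 : ℝ) 1

/-- `Y`-periodicity: invariance under translation by `ℤ^n`. -/
def YPeriodic {n : ℕ} {α : Type*} (f : (Fin n → ℝ) → α) : Prop :=
  ∀ (x : Fin n → ℝ) (k : Fin n → ℤ), f (x + fun i => (k i : ℝ)) = f x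

/-- `f ∈ L^p_per(Y)`: the function is `Y`-periodic and its restriction to `Y` is in `L^p(Y)`.
Functions are representatives of their almost everywhere classes. -/
def MemLpPer {n : ℕ} (p : ENNReal) (f : (Fin n → ℝ) → ℝ) : Prop :=
  YPeriodic f ∧ MemLp f p (volume.restrict (unitCell n))

/-- The classical partial derivative `∂_i φ (x)`. -/
noncomputable def classicalPartial {n : ℕ} (i : Fin n) (φ : (Fin n → ℝ) → ℝ) (x : Fin n → ℝ) : ℝ :=
  fderiv ℝ φ x (Pi.single i 1)

/-- `g` is a weak partial derivative `∂_i u` of the `Y`-periodic function `u`: integration by parts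
holds against every test function in `C^∞_per(Y)`. -/
def HasWeakPartial {n : ℕ} (i : Fin n) (u g : (Fin n → ℝ) → ℝ) : Prop :=
  ∀ φ : (Fin n → ℝ) → ℝ, ContDiff ℝ ∞ φ → YPeriodic φ →
    ∫ x in unitCell n, u x * classicalPartial i φ x = - ∫ x in unitCell n, g x * φ x

/-- `u` has a weak partial derivative `∂_i u` in `L^2_per(Y)`. -/
def HasL2WeakPartial {n : ℕ} (i : Fin n) (u : (Fin n → ℝ) → ℝ) : Prop :=
  ∃ g : (Fin n → ℝ) → ℝ, MemLpPer 2 g ∧ HasWeakPartial i u g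

open Classical in
/-- A representative in `L^2_per(Y)` of the weak partial derivative `∂_i u` (which is unique up to
almost everywhere equality), if there is one. -/
noncomputable def weakPartial {n : ℕ} (i : Fin n) (u : (Fin n → ℝ) → ℝ) : (Fin n → ℝ) → ℝ :=
  if h : HasL2WeakPartial i u then h.choose else 0

/-- `u ∈ H^1_per(Y)`. -/
def MemH1Per {n : ℕ} (u : (Fin n → ℝ) → ℝ) : Prop :=
  MemLpPer 2 u ∧ ∀ i, HasL2WeakPartial i u

/-- `u ∈ H^2_per(Y)`. -/
def MemH2Per {n : ℕ} (u : (Fin n → ℝ) → ℝ) : Prop :=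
  MemH1Per u ∧ ∀ i, MemH1Per (weakPartial i u)

/-- `F ∈ L^2_per(Y; ℝ^n)`. -/
def MemL2PerVec {n : ℕ} (F : (Fin n → ℝ) → (Fin n → ℝ)) : Prop :=
  ∀ i, MemLpPer 2 (fun x => F x i)

/-- `w ∈ H^1_{per,0}(Y; ℝ^n)`: every component is in `H^1_per(Y)` and has mean zero. -/
def MemH1PerZeroVec {n : ℕ} (w : (Fin n → ℝ) → (Fin n → ℝ)) : Prop :=
  ∀ i, MemH1Per (fun x => w x i) ∧ ∫ x in unitCell n, w x i = 0

/-- The weak gradient `∇φ`. -/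
noncomputable def weakGrad {n : ℕ} (φ : (Fin n → ℝ) → ℝ) (x : Fin n → ℝ) : Fin n → ℝ :=
  fun i => weakPartial i φ x

/-- The weak Hessian `D²φ`. -/
noncomputable def weakHess {n : ℕ} (φ : (Fin n → ℝ) → ℝ) (x : Fin n → ℝ) :
    Matrix (Fin n) (Fin n) ℝ :=
  Matrix.of fun i j => weakPartial j (weakPartial i φ) x

/-- The weak Jacobian `Dw`, with entries `(Dw)_{ij} = ∂_j w_i`. -/
noncomputable def weakJac {n : ℕ} (w : (Fin n → ℝ) → (Fin n → ℝ)) (x : Fin n → ℝ) :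
    Matrix (Fin n) (Fin n) ℝ :=
  Matrix.of fun i j => weakPartial j (fun y => w y i) x

/-- The weak divergence `∇·w`. -/
noncomputable def weakDiv {n : ℕ} (w : (Fin n → ℝ) → (Fin n → ℝ)) (x : Fin n → ℝ) : ℝ :=
  ∑ i, weakPartial i (fun y => w y i) x

/-- The Frobenius product `M : N`. -/
def frob {n : ℕ} (M N : Matrix (Fin n) (Fin n) ℝ) : ℝ := ∑ i, ∑ j, M i j * N i j

/-- The setting `𝓑`: bounded measurable periodic coefficients with `A` symmetric and uniformly
elliptic, subject to the Cordes-type condition. -/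
structure SettingB {n : ℕ} (A : (Fin n → ℝ) → Matrix (Fin n) (Fin n) ℝ)
    (b : (Fin n → ℝ) → (Fin n → ℝ)) : Prop where
  bounded_A : ∀ i j, MemLpPer ⊤ (fun x => A x i j)
  bounded_b : ∀ i, MemLpPer ⊤ (fun x => b x i)
  symm : ∀ᵐ x, (A x).IsSymm
  elliptic : ∃ lam Lam : ℝ, 0 < lam ∧ 0 < Lam ∧ ∀ᵐ x, ∀ ξ : Fin n → ℝ,
    lam * (ξ ⬝ᵥ ξ) ≤ ξ ⬝ᵥ (A x *ᵥ ξ) ∧ ξ ⬝ᵥ (A x *ᵥ ξ) ≤ Lam * (ξ ⬝ᵥ ξ)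
  cordes : ∃ δ : ℝ, (n : ℝ) / (n + Real.pi ^ 2) < δ ∧ δ ≤ 1 ∧ ∀ᵐ x,
    (frob (A x) (A x) + b x ⬝ᵥ b x) / (A x).trace ^ 2 ≤ 1 / ((n : ℝ) - 1 + δ)

/-- The renormalization function `γ = tr(A) / (|A|² + |b|²)`. -/
noncomputable def gam {n : ℕ} (A : (Fin n → ℝ) → Matrix (Fin n) (Fin n) ℝ)
    (b : (Fin n → ℝ) → (Fin n → ℝ)) (x : Fin n → ℝ) : ℝ :=
  (A x).trace / (frob (A x) (A x) + b x ⬝ᵥ b x)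

/-- The renormalized diffusion matrix `Ã = γ A`. -/
noncomputable def renormA {n : ℕ} (A : (Fin n → ℝ) → Matrix (Fin n) (Fin n) ℝ)
    (b : (Fin n → ℝ) → (Fin n → ℝ)) (x : Fin n → ℝ) : Matrix (Fin n) (Fin n) ℝ :=
  gam A b x • A x

/-- The renormalized drift `b̃ = γ b`. -/
noncomputable def renormB {n : ℕ} (A : (Fin n → ℝ) → Matrix (Fin n) (Fin n) ℝ)
    (b : (Fin n → ℝ) → (Fin n → ℝ)) (x : Fin n → ℝ) : Fin n → ℝ :=
  gam A b x • b x

/-- `u ∈ L^2_per(Y)` is a (very weak) solution of `-D²:(Au) + ∇·(bu) = ∇·F` in `Y`, `u` being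
`Y`-periodic: all derivatives are moved onto test functions in `H^2_per(Y)`. -/
def IsFPKSolution {n : ℕ} (A : (Fin n → ℝ) → Matrix (Fin n) (Fin n) ℝ)
    (b F : (Fin n → ℝ) → (Fin n → ℝ)) (u : (Fin n → ℝ) → ℝ) : Prop :=
  MemLpPer 2 u ∧ ∀ φ : (Fin n → ℝ) → ℝ, MemH2Per φ →
    (∫ x in unitCell n, u x * frob (A x) (weakHess φ x))
      + (∫ x in unitCell n, u x * (b x ⬝ᵥ weakGrad φ x))
      = ∫ x in unitCell n, F x ⬝ᵥ weakGrad φ x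

/-- The bilinear form
`B₂(v,w) = ∫_Y (∇·v)(Ã:Dw + b̃·w) + 1/2 ∫_Y (Dv - (Dv)ᵀ):(Dw - (Dw)ᵀ)`,
in which `Ã`, `b̃` are the renormalizations of `A`, `b`. -/
noncomputable def B2 {n : ℕ} (A : (Fin n → ℝ) → Matrix (Fin n) (Fin n) ℝ)
    (b v w : (Fin n → ℝ) → (Fin n → ℝ)) : ℝ :=
  (∫ x in unitCell n, weakDiv v x *
      (frob (renormA A b x) (weakJac w x) + renormB A b x ⬝ᵥ w x))
    + 1 / 2 * ∫ x in unitCell n,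
      frob (weakJac v x - (weakJac v x)ᵀ) (weakJac w x - (weakJac w x)ᵀ)

/-- `r` is a solution in `L^2_per(Y)` of the renormalized homogeneous problem
`-D²:(Ãr) + ∇·(b̃r) = 0` with `∫_Y r = 1`. -/
def IsRenormInvariant {n : ℕ} (A : (Fin n → ℝ) → Matrix (Fin n) (Fin n) ℝ)
    (b : (Fin n → ℝ) → (Fin n → ℝ)) (r : (Fin n → ℝ) → ℝ) : Prop :=
  IsFPKSolution (renormA A b) (renormB A b) 0 r ∧ ∫ x in unitCell n, r x = 1

/-- `ρ ∈ H^1_{per,0}(Y; ℝ^n)` satisfies `B₂(ρ,w) = -∫_Y F·w` for all `w ∈ H^1_{per,0}(Y; ℝ^n)`. -/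
def IsAuxSolution {n : ℕ} (A : (Fin n → ℝ) → Matrix (Fin n) (Fin n) ℝ)
    (b F ρ : (Fin n → ℝ) → (Fin n → ℝ)) : Prop :=
  MemH1PerZeroVec ρ ∧ ∀ w : (Fin n → ℝ) → (Fin n → ℝ), MemH1PerZeroVec w →
    B2 A b ρ w = - ∫ x in unitCell n, F x ⬝ᵥ w x

end CordesFPK

open CordesFPK

/-!
Let `‖·‖` be the norm of `L²(Y)`. In Fourier coefficients `∂ᵢ` becomes multiplication by `2πikᵢ`,
which yields for periodic mean-zero fields `w` both the div-curl identity
`‖Dw‖² = ‖∇ · w‖² + ½ ‖Dw - Dwᵀ‖²` and the Poincaré inequality `4π² ‖w‖² ≤ ‖Dw‖²`. The Cordes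
condition says pointwise that `|Ã - I|² + |b̃|² ≤ 1 - δ`, so `Ã : Dw + b̃ · w` differs from `∇ · w`
by at most `((1 - δ) (1 + 1 / (4π²)))^(1/2) ‖Dw‖`, where the factor is less than `1`. By the
div-curl identity `B₂` is therefore coercive, and Lax-Milgram applies.

On gradients `w = ∇φ` the skew part of `B₂` vanishes, so `-∇ · ρ̃₀` solves `(P_F)`. Every mean-zero
function of `L²(Y)` is the divergence of such a field, so coercivity also gives uniqueness among
functions with prescribed mean. Finally `r̃ = 1 - ∇ · ρ`, where `ρ` solves the auxiliary problem
whose right-hand side cancels the residual of the constant function `1`.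
-/

namespace CordesFPK

open scoped ComplexConjugate InnerProductSpace

noncomputable section

variable {n : ℕ}

/-- Lebesgue measure on the unit cell. -/
abbrev cellMeasure (n : ℕ) : Measure (Fin n → ℝ) := volume.restrict (unitCell n)

/-- The real space `L²(Y)`. -/
abbrev L2Cell (n : ℕ) := Lp ℝ 2 (cellMeasure n)

lemma measurableSet_unitCell (n : ℕ) : MeasurableSet (unitCell n) :=
  MeasurableSet.univ_pi fun _ => measurableSet_Ioo

instance (n : ℕ) : IsProbabilityMeasure (cellMeasure n) :=
  ⟨by simp [cellMeasure, unitCell, Real.volume_pi_Ioo]⟩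

lemma cellMeasure_eq_Icc (n : ℕ) : cellMeasure n = volume.restrict (Set.Icc 0 1) :=
  Measure.restrict_congr_set Measure.univ_pi_Ioo_ae_eq_Icc

lemma cellMeasure_eq_Ioc (n : ℕ) :
    cellMeasure n = volume.restrict (Set.univ.pi fun _ => Set.Ioc 0 1) := by
  rw [cellMeasure_eq_Icc]
  exact Measure.restrict_congr_set Measure.univ_pi_Ioc_ae_eq_Icc.symm

/-- Normalised Haar measure on the torus `ℝⁿ/ℤⁿ`. -/
abbrev torusMeasure (n : ℕ) : Measure (UnitAddTorus (Fin n)) :=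
  Measure.pi fun _ => AddCircle.haarAddCircle

/-- The covering map `ℝⁿ → ℝⁿ/ℤⁿ`. -/
def toTorus (x : Fin n → ℝ) : UnitAddTorus (Fin n) := fun i => x i

/-- The section of the covering map with values in `(0,1]ⁿ`. -/
def ofTorus (y : UnitAddTorus (Fin n)) : Fin n → ℝ := UnitAddTorus.measurableEquivPiIoc 0 y

lemma measurable_ofTorus : Measurable (ofTorus (n := n)) :=
  measurable_subtype_coe.comp (UnitAddTorus.measurableEquivPiIoc 0).measurable

lemma ofTorus_toTorus {x : Fin n → ℝ} (hx : x ∈ unitCell n) : ofTorus (toTorus x) = x :=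
  congrArg Subtype.val <| (UnitAddTorus.measurableEquivPiIoc 0).apply_symm_apply
    ⟨x, fun i => by simpa using Set.Ioo_subset_Ioc_self (hx i trivial)⟩

lemma measurePreserving_toTorus (n : ℕ) :
    MeasurePreserving toTorus (cellMeasure n) (torusMeasure n) := by
  have hcircle : MeasurePreserving (fun x : ℝ => (x : UnitAddCircle))
      (volume.restrict (Set.Ioc 0 1)) AddCircle.haarAddCircle := by
    simpa [volume, AddCircle.haarAddCircle] using UnitAddCircle.measurePreserving_mk 0
  rw [cellMeasure_eq_Ioc, volume_pi, Measure.restrict_pi_pi]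
  exact measurePreserving_pi _ _ fun _ => hcircle

lemma ofTorus_comp_toTorus_ae_eq : ofTorus ∘ toTorus =ᵐ[cellMeasure n] id := by
  filter_upwards [ae_restrict_mem (measurableSet_unitCell n)] with x hx
  exact ofTorus_toTorus hx

lemma measurePreserving_ofTorus (n : ℕ) :
    MeasurePreserving ofTorus (torusMeasure n) (cellMeasure n) := by
  refine ⟨measurable_ofTorus, ?_⟩
  rw [← (measurePreserving_toTorus n).map_eq,
    Measure.map_map measurable_ofTorus (measurePreserving_toTorus n).measurable,
    Measure.map_congr ofTorus_comp_toTorus_ae_eq, Measure.map_id]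

/-- Composition with the covering map, as a unitary map between the complex `L²` spaces. -/
def torusIso (n : ℕ) : Lp ℂ 2 (torusMeasure n) ≃ₗᵢ[ℂ] Lp ℂ 2 (cellMeasure n) :=
  LinearIsometryEquiv.ofSurjective
    (Lp.compMeasurePreservingₗᵢ ℂ toTorus (measurePreserving_toTorus n)) fun f => by
      refine ⟨Lp.compMeasurePreserving ofTorus (measurePreserving_ofTorus n) f, Lp.ext ?_⟩
      calc _ =ᵐ[cellMeasure n] _ ∘ toTorus := Lp.coeFn_compMeasurePreserving _ _
        _ =ᵐ[cellMeasure n] (f ∘ ofTorus) ∘ toTorus :=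
          (measurePreserving_toTorus n).quasiMeasurePreserving.ae_eq_comp
            (Lp.coeFn_compMeasurePreserving f _)
        _ =ᵐ[cellMeasure n] f := ofTorus_comp_toTorus_ae_eq.fun_comp f

lemma coeFn_torusIso (f : Lp ℂ 2 (torusMeasure n)) :
    torusIso n f =ᵐ[cellMeasure n] f ∘ toTorus :=
  Lp.coeFn_compMeasurePreserving f (measurePreserving_toTorus n)

/-- The character `x ↦ exp (2πi k·x)`. -/
def character (k : Fin n → ℤ) (x : Fin n → ℝ) : ℂ :=
  Complex.exp (2 * Real.pi * Complex.I * ∑ j, (k j : ℂ) * (x j : ℂ))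

lemma mFourier_toTorus (k : Fin n → ℤ) (x : Fin n → ℝ) :
    UnitAddTorus.mFourier k (toTorus x) = character k x := by
  simp only [UnitAddTorus.mFourier, ContinuousMap.coe_mk, toTorus, character, Finset.mul_sum,
    Complex.exp_sum, fourier_coe_apply, Complex.ofReal_one, div_one, mul_assoc]

lemma conj_character (k : Fin n → ℤ) (x : Fin n → ℝ) :
    conj (character k x) = character (-k) x := by
  rw [← mFourier_toTorus, ← mFourier_toTorus, UnitAddTorus.mFourier_neg]

/-- The orthonormal basis of characters of `L²(Y; ℂ)`. -/
def cellBasis (n : ℕ) : HilbertBasis (Fin n → ℤ) ℂ (Lp ℂ 2 (cellMeasure n)) :=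
  HilbertBasis.ofRepr ((torusIso n).symm.trans (UnitAddTorus.mFourierBasis (d := Fin n)).repr)

lemma coeFn_cellBasis (k : Fin n → ℤ) : cellBasis n k =ᵐ[cellMeasure n] character k := by
  have h : cellBasis n k = torusIso n (UnitAddTorus.mFourierLp 2 k) := by
    rw [← UnitAddTorus.coe_mFourierBasis]
    rfl
  calc cellBasis n k =ᵐ[cellMeasure n] UnitAddTorus.mFourierLp 2 k ∘ toTorus :=
        h ▸ coeFn_torusIso _
    _ =ᵐ[cellMeasure n] UnitAddTorus.mFourier k ∘ toTorus :=
        (measurePreserving_toTorus n).quasiMeasurePreserving.ae_eq_comp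
          (UnitAddTorus.coeFn_mFourierLp 2 k)
    _ = character k := funext fun x => mFourier_toTorus k x

lemma cellBasis_mul_ae_eq (k : Fin n → ℤ) (f : Lp ℂ 2 (cellMeasure n)) :
    (fun x => ⟪cellBasis n k x, f x⟫_ℂ) =ᵐ[cellMeasure n] fun x => f x * conj (character k x) := by
  filter_upwards [coeFn_cellBasis k] with x hx
  rw [hx, RCLike.inner_apply]

lemma integrable_mul_conj_character (k : Fin n → ℤ) (f : Lp ℂ 2 (cellMeasure n)) :
    Integrable (fun x => f x * conj (character k x)) (cellMeasure n) :=
  (L2.integrable_inner (cellBasis n k) f).congr (cellBasis_mul_ae_eq k f)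

lemma cellBasis_repr_eq_integral (k : Fin n → ℤ) (f : Lp ℂ 2 (cellMeasure n)) :
    (cellBasis n).repr f k = ∫ x, f x * conj (character k x) ∂(cellMeasure n) := by
  rw [HilbertBasis.repr_apply_apply, L2.inner_def]
  exact integral_congr_ae (cellBasis_mul_ae_eq k f)

/-- The inclusion of `L²(Y)` into `L²(Y; ℂ)`. -/
def complexify (n : ℕ) : L2Cell n →L[ℝ] Lp ℂ 2 (cellMeasure n) :=
  Complex.ofRealCLM.compLpL 2 (cellMeasure n)

lemma coeFn_complexify (u : L2Cell n) : complexify n u =ᵐ[cellMeasure n] fun x => (u x : ℂ) :=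
  Complex.ofRealCLM.coeFn_compLpL u

lemma inner_complexify (u v : L2Cell n) : ⟪complexify n u, complexify n v⟫_ℂ = (⟪u, v⟫_ℝ : ℝ) := by
  rw [L2.inner_def, L2.inner_def, ← integral_complex_ofReal]
  refine integral_congr_ae ?_
  filter_upwards [coeFn_complexify u, coeFn_complexify v] with x hu hv
  simp [hu, hv]

/-- The `k`-th Fourier coefficient of a real square integrable function on the cell. -/
def cellFourierCoeff (k : Fin n → ℤ) : L2Cell n →L[ℝ] ℂ :=
  ((innerSL ℂ (cellBasis n k)).restrictScalars ℝ).comp (complexify n)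

lemma cellFourierCoeff_eq_repr (k : Fin n → ℤ) (u : L2Cell n) :
    cellFourierCoeff k u = (cellBasis n).repr (complexify n u) k :=
  ((cellBasis n).repr_apply_apply _ k).symm

lemma cellFourierCoeff_eq_integral (k : Fin n → ℤ) (u : L2Cell n) :
    cellFourierCoeff k u = ∫ x, (u x : ℂ) * conj (character k x) ∂(cellMeasure n) := by
  rw [cellFourierCoeff_eq_repr, cellBasis_repr_eq_integral]
  refine integral_congr_ae ?_
  filter_upwards [coeFn_complexify u] with x hx
  rw [hx]

lemma cellFourierCoeff_neg (k : Fin n → ℤ) (u : L2Cell n) :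
    cellFourierCoeff (-k) u = conj (cellFourierCoeff k u) := by
  simp only [cellFourierCoeff_eq_integral, ← integral_conj, map_mul, Complex.conj_ofReal,
    conj_character, neg_neg]

lemma hasSum_conj_cellFourierCoeff_mul (u v : L2Cell n) :
    HasSum (fun k => conj (cellFourierCoeff k u) * cellFourierCoeff k v) ((⟪u, v⟫_ℝ : ℝ) : ℂ) := by
  rw [← inner_complexify]
  refine ((cellBasis n).hasSum_inner_mul_inner _ _).congr_fun fun k => ?_
  rw [← inner_conj_symm]
  rfl

lemma hasSum_norm_cellFourierCoeff_sq (u : L2Cell n) :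
    HasSum (fun k => ‖cellFourierCoeff k u‖ ^ 2) (‖u‖ ^ 2) := by
  rw [← Complex.hasSum_ofReal, ← real_inner_self_eq_norm_sq]
  simpa [Complex.conj_mul'] using hasSum_conj_cellFourierCoeff_mul u u

lemma eq_of_cellFourierCoeff_eq {u v : L2Cell n}
    (h : ∀ k, cellFourierCoeff k u = cellFourierCoeff k v) : u = v := by
  have hzero := hasSum_norm_cellFourierCoeff_sq (u - v)
  simp only [map_sub, h, sub_self, norm_zero, zero_pow two_ne_zero] at hzero
  have := hzero.unique hasSum_zero
  rwa [sq_eq_zero_iff, norm_eq_zero, sub_eq_zero] at this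

lemma cellFourierCoeff_re (k : Fin n → ℤ) (f : Lp ℂ 2 (cellMeasure n)) :
    cellFourierCoeff k (Complex.reCLM.compLpL 2 (cellMeasure n) f) =
      ((cellBasis n).repr f k + conj ((cellBasis n).repr f (-k))) / 2 := by
  have hpt : ∀ x, ((f x).re : ℂ) * conj (character k x) =
      (f x * conj (character k x) + conj (f x * conj (character (-k) x))) / 2 := fun x => by
    rw [Complex.re_eq_add_conj, map_mul, ← conj_character]
    simp only [conj_character, neg_neg]
    ring
  calc cellFourierCoeff k (Complex.reCLM.compLpL 2 (cellMeasure n) f)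
      = ∫ x, (f x * conj (character k x) + conj (f x * conj (character (-k) x))) / 2
          ∂(cellMeasure n) := by
        rw [cellFourierCoeff_eq_integral]
        refine integral_congr_ae ?_
        filter_upwards [Complex.reCLM.coeFn_compLpL (p := 2) f] with x hx
        rw [hx, ← hpt, Complex.reCLM_apply]
    _ = _ := by
        rw [integral_div, integral_add (integrable_mul_conj_character k f), integral_conj,
          cellBasis_repr_eq_integral, cellBasis_repr_eq_integral]
        exact Complex.conjCLE.toContinuousLinearMap.integrable_comp
          (integrable_mul_conj_character (-k) f)

lemma exists_cellFourierCoeff_eq {c : (Fin n → ℤ) → ℂ} {f : L2Cell n}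
    (hle : ∀ k, ‖c k‖ ≤ ‖cellFourierCoeff k f‖) (hsymm : ∀ k, c (-k) = conj (c k)) :
    ∃ u : L2Cell n, ∀ k, cellFourierCoeff k u = c k := by
  have hc : Memℓp c 2 := memℓp_gen <| by
    refine .of_nonneg_of_le (fun k => by positivity) (fun k => ?_)
      (hasSum_norm_cellFourierCoeff_sq f).summable
    simpa using pow_le_pow_left₀ (norm_nonneg _) (hle k) 2
  refine ⟨Complex.reCLM.compLpL 2 _ ((cellBasis n).repr.symm ⟨c, hc⟩), fun k => ?_⟩
  simp [cellFourierCoeff_re, hsymm]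

section WeakDerivatives

lemma memLp_cell_of_continuous {E : Type*} [NormedAddCommGroup E] {f : (Fin n → ℝ) → E}
    (hf : Continuous f) (p : ENNReal) : MemLp f p (cellMeasure n) := by
  obtain ⟨C, hC⟩ := (isCompact_Icc (a := (0 : Fin n → ℝ)) (b := 1)).exists_bound_of_continuousOn
    hf.continuousOn
  refine MemLp.of_bound hf.aestronglyMeasurable C ?_
  rw [cellMeasure_eq_Icc]
  exact (ae_restrict_mem measurableSet_Icc).mono hC

lemma continuous_classicalPartial {φ : (Fin n → ℝ) → ℝ} (hφ : ContDiff ℝ ∞ φ) (i : Fin n) :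
    Continuous (classicalPartial i φ) :=
  (hφ.continuous_fderiv (by simp)).clm_apply continuous_const

lemma YPeriodic.insertNth_zero_eq_one {α : Type*} {f : (Fin (n + 1) → ℝ) → α} (hf : YPeriodic f)
    (i : Fin (n + 1)) (x : Fin n → ℝ) : f (i.insertNth 0 x) = f (i.insertNth 1 x) := by
  rw [← hf (i.insertNth 0 x) (Pi.single i 1)]
  congr 1
  funext l
  cases l using Fin.succAboveCases i <;> simp

lemma integral_classicalPartial_eq_zero {φ : (Fin n → ℝ) → ℝ} (hφ : ContDiff ℝ ∞ φ)
    (hper : YPeriodic φ) (i : Fin n) : ∫ x, classicalPartial i φ x ∂(cellMeasure n) = 0 := by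
  obtain _ | m := n
  · exact i.elim0
  let f' (x : Fin (m + 1) → ℝ) := (ContinuousLinearMap.single ℝ (fun _ => ℝ) i).comp (fderiv ℝ φ x)
  have hdiv : ∀ x, ∑ j, f' x (Pi.single j 1) j = classicalPartial i φ x := fun x => by
    simp [f', classicalPartial, Pi.single_apply]
  have hint : IntegrableOn (fun x => ∑ j, f' x (Pi.single j 1) j) (Set.Icc 0 1) := by
    simp only [hdiv]
    exact (continuous_classicalPartial hφ i).continuousOn.integrableOn_compact isCompact_Icc
  have hfaces := integral_divergence_of_hasFDerivAt_off_countable 0 1 zero_le_one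
    (fun x => Pi.single i (φ x)) f' ∅ Set.countable_empty
    ((continuous_single i).comp hφ.continuous).continuousOn
    (fun x _ => (ContinuousLinearMap.single ℝ (fun _ => ℝ) i).hasFDerivAt.comp x
      (hφ.differentiable (by simp) x).hasFDerivAt) hint
  simp only [hdiv] at hfaces
  rw [cellMeasure_eq_Icc, hfaces]
  refine Finset.sum_eq_zero fun j _ => sub_eq_zero.2 ?_
  congr 1 with x
  by_cases hj : j = i
  · subst hj
    simp [hper.insertNth_zero_eq_one]
  · simp [hj]

lemma classicalPartial_mul {φ ψ : (Fin n → ℝ) → ℝ} (hφ : ContDiff ℝ ∞ φ) (hψ : ContDiff ℝ ∞ ψ)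
    (i : Fin n) (x : Fin n → ℝ) : classicalPartial i (fun y => φ y * ψ y) x =
      φ x * classicalPartial i ψ x + classicalPartial i φ x * ψ x := by
  unfold classicalPartial
  rw [fderiv_fun_mul (hφ.differentiable (by simp) x) (hψ.differentiable (by simp) x)]
  simp [mul_comm]

lemma hasWeakPartial_classicalPartial {φ : (Fin n → ℝ) → ℝ} (hφ : ContDiff ℝ ∞ φ)
    (hper : YPeriodic φ) (i : Fin n) : HasWeakPartial i φ (classicalPartial i φ) := by
  intro ψ hψ hψper
  have hint {f : (Fin n → ℝ) → ℝ} (hf : Continuous f) : Integrable f (cellMeasure n) :=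
    memLp_one_iff_integrable.1 (memLp_cell_of_continuous hf 1)
  have hzero := integral_classicalPartial_eq_zero (hφ.mul hψ)
    (fun x k => by simp only [hper x k, hψper x k]) i
  simp only [classicalPartial_mul hφ hψ] at hzero
  rw [← add_eq_zero_iff_eq_neg, ← hzero]
  exact (integral_add (hint (hφ.continuous.mul (continuous_classicalPartial hψ i)))
    (hint ((continuous_classicalPartial hφ i).mul hψ.continuous))).symm

lemma HasWeakPartial.congr {i : Fin n} {u u' g g' : (Fin n → ℝ) → ℝ} (h : HasWeakPartial i u g)
    (hu : u =ᵐ[cellMeasure n] u') (hg : g =ᵐ[cellMeasure n] g') : HasWeakPartial i u' g' := by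
  intro φ hφ hper
  calc ∫ x in unitCell n, u' x * classicalPartial i φ x
      = ∫ x in unitCell n, u x * classicalPartial i φ x :=
        integral_congr_ae (hu.symm.mul .rfl)
    _ = - ∫ x in unitCell n, g x * φ x := h φ hφ hper
    _ = - ∫ x in unitCell n, g' x * φ x := congrArg _ (integral_congr_ae (hg.mul .rfl))

/-- The Fourier symbol `2πi kᵢ` of the partial derivative `∂ᵢ`. -/
def partialSymbol (i : Fin n) (k : Fin n → ℤ) : ℂ := 2 * Real.pi * Complex.I * k i

lemma conj_partialSymbol (i : Fin n) (k : Fin n → ℤ) :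
    conj (partialSymbol i k) = -partialSymbol i k := by
  simp [partialSymbol, map_ofNat]

lemma partialSymbol_neg (i : Fin n) (k : Fin n → ℤ) :
    partialSymbol i (-k) = -partialSymbol i k := by
  simp [partialSymbol]

lemma norm_partialSymbol (i : Fin n) (k : Fin n → ℤ) :
    ‖partialSymbol i k‖ = 2 * Real.pi * |(k i : ℝ)| := by
  simp [partialSymbol, abs_of_pos Real.pi_pos]

lemma character_eq_exp_sum (k : Fin n → ℤ) :
    character k = fun x => Complex.exp (∑ j, partialSymbol j k * (x j : ℂ)) := by
  funext x
  simp only [character, partialSymbol, Finset.mul_sum, mul_assoc]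

lemma contDiff_character (k : Fin n → ℤ) : ContDiff ℝ ∞ (character k) := by
  rw [character_eq_exp_sum]
  exact ContDiff.cexp <| ContDiff.sum fun j _ =>
    contDiff_const.mul (Complex.ofRealCLM.contDiff.comp (contDiff_apply ℝ ℝ j))

lemma fderiv_character (k : Fin n → ℤ) (i : Fin n) (x : Fin n → ℝ) :
    fderiv ℝ (character k) x (Pi.single i 1) = partialSymbol i k * character k x := by
  let coord (j : Fin n) : (Fin n → ℝ) →L[ℝ] ℂ := Complex.ofRealCLM.comp (.proj j)
  have hexponent : HasFDerivAt (fun y : Fin n → ℝ => ∑ j, partialSymbol j k * (y j : ℂ))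
      (∑ j, partialSymbol j k • coord j) x :=
    .fun_sum fun j _ => (coord j).hasFDerivAt.const_mul _
  rw [character_eq_exp_sum, hexponent.cexp.fderiv]
  simp [coord, Pi.single_apply, apply_ite Complex.ofReal, mul_comm]

lemma yPeriodic_character (k : Fin n → ℤ) : YPeriodic (character k) := fun x m => by
  rw [← mFourier_toTorus, ← mFourier_toTorus]
  congr 1
  funext i
  simp [toTorus]

lemma HasWeakPartial.integral_mul_fderiv {i : Fin n} {u g : L2Cell n} (h : HasWeakPartial i u g)
    {Ψ : (Fin n → ℝ) → ℂ} (hΨ : ContDiff ℝ ∞ Ψ) (hper : YPeriodic Ψ) :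
    ∫ x, (u x : ℂ) * fderiv ℝ Ψ x (Pi.single i 1) ∂(cellMeasure n) =
      -∫ x, (g x : ℂ) * Ψ x ∂(cellMeasure n) := by
  have hint (f : L2Cell n) {Φ : (Fin n → ℝ) → ℂ} (hΦ : Continuous Φ) :
      Integrable (fun x => (f x : ℂ) * Φ x) (cellMeasure n) :=
    (Lp.memLp f).ofReal.integrable_mul (memLp_cell_of_continuous hΦ 2)
  have hcont : Continuous fun x => fderiv ℝ Ψ x (Pi.single i 1) :=
    (hΨ.continuous_fderiv (by simp)).clm_apply continuous_const
  have hreal (T : ℂ →L[ℝ] ℝ) (hT : ∀ (r : ℝ) z, T (r * z) = r * T z) :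
      T (∫ x, (u x : ℂ) * fderiv ℝ Ψ x (Pi.single i 1) ∂(cellMeasure n)) =
        T (-∫ x, (g x : ℂ) * Ψ x ∂(cellMeasure n)) := by
    have hpartial (x) : classicalPartial i (T ∘ Ψ) x = T (fderiv ℝ Ψ x (Pi.single i 1)) := by
      rw [classicalPartial,
        (T.hasFDerivAt.comp x (hΨ.differentiable (by simp) x).hasFDerivAt).fderiv]
      rfl
    have htest := h (T ∘ Ψ) (T.contDiff.comp hΨ) fun x k => congrArg T (hper x k)
    rw [map_neg, ← T.integral_comp_comm (hint u hcont),
      ← T.integral_comp_comm (hint g hΨ.continuous)]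
    simpa only [hT, hpartial, Function.comp_apply] using htest
  exact Complex.ext (hreal Complex.reCLM (by simp)) (hreal Complex.imCLM (by simp))

/-- `g = ∂ᵢu` for square integrable functions on the cell, in terms of Fourier coefficients. -/
def IsPartial (i : Fin n) (u g : L2Cell n) : Prop :=
  ∀ k, cellFourierCoeff k g = partialSymbol i k * cellFourierCoeff k u

lemma HasWeakPartial.isPartial {i : Fin n} {u g : L2Cell n} (h : HasWeakPartial i u g) :
    IsPartial i u g := fun k => by
  have htest := h.integral_mul_fderiv (contDiff_character (-k)) (yPeriodic_character (-k))
  simp only [fderiv_character, partialSymbol_neg, mul_left_comm _ (-partialSymbol i k),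
    ← conj_character] at htest
  rw [integral_const_mul, neg_mul, neg_inj] at htest
  rw [cellFourierCoeff_eq_integral, cellFourierCoeff_eq_integral, htest]

lemma IsPartial.inner_right_eq_neg {i : Fin n} {u g v h : L2Cell n} (hu : IsPartial i u g)
    (hv : IsPartial i v h) : ⟪u, h⟫_ℝ = -⟪g, v⟫_ℝ := by
  rw [← Complex.ofReal_inj, Complex.ofReal_neg]
  refine (hasSum_conj_cellFourierCoeff_mul u h).unique
    ((hasSum_conj_cellFourierCoeff_mul g v).neg.congr_fun fun k => ?_)
  rw [hu k, hv k, map_mul, conj_partialSymbol]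
  ring

lemma inner_toLp (u : L2Cell n) {φ : (Fin n → ℝ) → ℝ} (hφ : MemLp φ 2 (cellMeasure n)) :
    ⟪u, hφ.toLp φ⟫_ℝ = ∫ x in unitCell n, u x * φ x := by
  rw [L2.inner_def]
  refine integral_congr_ae ?_
  filter_upwards [hφ.coeFn_toLp] with x hx
  simp [hx, mul_comm]

lemma hasWeakPartial_iff_isPartial {i : Fin n} {u g : L2Cell n} :
    HasWeakPartial i u g ↔ IsPartial i u g := by
  refine ⟨HasWeakPartial.isPartial, fun h φ hφ hper => ?_⟩
  have hφ₂ := memLp_cell_of_continuous hφ.continuous 2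
  have hdφ₂ := memLp_cell_of_continuous (continuous_classicalPartial hφ i) 2
  have hφpartial : IsPartial i (hφ₂.toLp φ) (hdφ₂.toLp _) :=
    ((hasWeakPartial_classicalPartial hφ hper i).congr hφ₂.coeFn_toLp.symm
      hdφ₂.coeFn_toLp.symm).isPartial
  rw [← inner_toLp u hdφ₂, ← inner_toLp g hφ₂]
  exact h.inner_right_eq_neg hφpartial

end WeakDerivatives

section FourierMultipliers

/-- The constant function `1` in `L²(Y)`. -/
def cellOne (n : ℕ) : L2Cell n := Lp.const 2 (cellMeasure n) 1

/-- The mean `∫_Y u` of `u ∈ L²(Y)`, realized as the inner product with the constant `1`. -/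
def cellMean (n : ℕ) : L2Cell n →L[ℝ] ℝ := innerSL ℝ (cellOne n)

lemma cellMean_eq_integral (u : L2Cell n) : cellMean n u = ∫ x, u x ∂(cellMeasure n) := by
  simp [cellMean, cellOne, L2.inner_def]

lemma cellMean_cellOne (n : ℕ) : cellMean n (cellOne n) = 1 := by
  simp [cellMean_eq_integral, cellOne]

lemma cellFourierCoeff_zero (u : L2Cell n) : cellFourierCoeff 0 u = cellMean n u := by
  simp [cellFourierCoeff_eq_integral, cellMean_eq_integral, ← integral_complex_ofReal, character]

lemma IsPartial.unique {i : Fin n} {u g g' : L2Cell n} (h : IsPartial i u g)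
    (h' : IsPartial i u g') : g = g' :=
  eq_of_cellFourierCoeff_eq fun k => (h k).trans (h' k).symm

lemma IsPartial.comm {i j : Fin n} {u p q r s : L2Cell n} (hp : IsPartial i u p)
    (hq : IsPartial j p q) (hr : IsPartial j u r) (hs : IsPartial i r s) : q = s :=
  eq_of_cellFourierCoeff_eq fun k => by rw [hq k, hp k, hs k, hr k, mul_left_comm]

lemma IsPartial.inner_swap {i j : Fin n} {u v p q r s : L2Cell n}
    (hp : IsPartial i u p) (hq : IsPartial j u q) (hr : IsPartial i v r) (hs : IsPartial j v s) :
    ⟪q, r⟫_ℝ = ⟪p, s⟫_ℝ := by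
  rw [← Complex.ofReal_inj]
  refine (hasSum_conj_cellFourierCoeff_mul q r).unique
    ((hasSum_conj_cellFourierCoeff_mul p s).congr_fun fun k => ?_)
  rw [hp k, hq k, hr k, hs k, map_mul, map_mul, conj_partialSymbol, conj_partialSymbol]
  ring

lemma IsPartial.cellMean_eq_zero {i : Fin n} {u g : L2Cell n} (h : IsPartial i u g) :
    cellMean n g = 0 := by
  have hzero := h 0
  rw [cellFourierCoeff_zero] at hzero
  simpa [partialSymbol] using hzero

/-- The Fourier symbol `∑ⱼ |2πi kⱼ|²` of `-Δ`. -/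
def laplaceSymbol (k : Fin n → ℤ) : ℝ := ∑ j, ‖partialSymbol j k‖ ^ 2

lemma laplaceSymbol_nonneg (k : Fin n → ℤ) : 0 ≤ laplaceSymbol k :=
  Finset.sum_nonneg fun _ _ => sq_nonneg _

lemma laplaceSymbol_neg (k : Fin n → ℤ) : laplaceSymbol (-k) = laplaceSymbol k := by
  simp [laplaceSymbol, partialSymbol_neg]

lemma sum_partialSymbol_mul_self (k : Fin n → ℤ) :
    ∑ i, partialSymbol i k * partialSymbol i k = -(laplaceSymbol k : ℂ) := by
  simp [laplaceSymbol, ← Complex.mul_conj', conj_partialSymbol]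

lemma norm_partialSymbol_sq_le (i : Fin n) (k : Fin n → ℤ) :
    ‖partialSymbol i k‖ ^ 2 ≤ laplaceSymbol k :=
  Finset.single_le_sum (f := fun j => ‖partialSymbol j k‖ ^ 2) (fun _ _ => sq_nonneg _)
    (Finset.mem_univ i)

lemma two_pi_le_norm_partialSymbol {i : Fin n} {k : Fin n → ℤ} (hk : k i ≠ 0) :
    2 * Real.pi ≤ ‖partialSymbol i k‖ := by
  rw [norm_partialSymbol]
  exact le_mul_of_one_le_right (by positivity) (mod_cast Int.one_le_abs hk)

lemma four_pi_sq_le_laplaceSymbol {k : Fin n → ℤ} (hk : k ≠ 0) :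
    4 * Real.pi ^ 2 ≤ laplaceSymbol k := by
  obtain ⟨i, hi⟩ := Function.ne_iff.mp hk
  calc 4 * Real.pi ^ 2 = (2 * Real.pi) ^ 2 := by ring
    _ ≤ ‖partialSymbol i k‖ ^ 2 := by gcongr; exact two_pi_le_norm_partialSymbol hi
    _ ≤ laplaceSymbol k := norm_partialSymbol_sq_le i k

lemma norm_partialSymbol_le (i : Fin n) (k : Fin n → ℤ) :
    ‖partialSymbol i k‖ ≤ laplaceSymbol k := by
  refine le_trans ?_ (norm_partialSymbol_sq_le i k)
  by_cases hk : k i = 0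
  · simp [partialSymbol, hk]
  · have := two_pi_le_norm_partialSymbol hk
    exact le_self_pow₀ (by linarith [Real.pi_gt_three]) two_ne_zero

lemma norm_partialSymbol_mul_le (i j : Fin n) (k : Fin n → ℤ) :
    ‖partialSymbol i k * partialSymbol j k‖ ≤ laplaceSymbol k := by
  rw [norm_mul]
  linarith [two_mul_le_add_sq ‖partialSymbol i k‖ ‖partialSymbol j k‖,
    norm_partialSymbol_sq_le i k, norm_partialSymbol_sq_le j k]

lemma poincare_inequality {u : L2Cell n} {g : Fin n → L2Cell n}
    (hu : cellMean n u = 0) (hg : ∀ j, IsPartial j u (g j)) :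
    4 * Real.pi ^ 2 * ‖u‖ ^ 2 ≤ ∑ j, ‖g j‖ ^ 2 := by
  refine hasSum_le (fun k => ?_) ((hasSum_norm_cellFourierCoeff_sq u).mul_left _)
    (hasSum_sum fun j _ => hasSum_norm_cellFourierCoeff_sq (g j))
  simp only [hg _ k, norm_mul, mul_pow, ← Finset.sum_mul]
  rcases eq_or_ne k 0 with rfl | hk
  · simp [cellFourierCoeff_zero, hu]
  · exact mul_le_mul_of_nonneg_right (four_pi_sq_le_laplaceSymbol hk) (sq_nonneg _)

lemma exists_isPartial {i : Fin n} {u f : L2Cell n}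
    (hle : ∀ k, ‖partialSymbol i k * cellFourierCoeff k u‖ ≤ ‖cellFourierCoeff k f‖) :
    ∃ g, IsPartial i u g :=
  exists_cellFourierCoeff_eq hle fun k => by
    rw [partialSymbol_neg, cellFourierCoeff_neg, map_mul, conj_partialSymbol]

lemma exists_cellFourierCoeff_eq_neg_div_laplaceSymbol (u : L2Cell n) :
    ∃ ψ : L2Cell n, ∀ k, cellFourierCoeff k ψ = -cellFourierCoeff k u / laplaceSymbol k := by
  refine exists_cellFourierCoeff_eq (f := u) (fun k => ?_) fun k => ?_
  · rw [norm_div, norm_neg, Complex.norm_of_nonneg (laplaceSymbol_nonneg k)]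
    rcases eq_or_ne k 0 with rfl | hk
    · simp [laplaceSymbol, partialSymbol]
    · have : 1 ≤ laplaceSymbol k :=
        le_trans (by nlinarith [Real.pi_gt_three]) (four_pi_sq_le_laplaceSymbol hk)
      exact div_le_self (norm_nonneg _) this
  · simp [laplaceSymbol_neg, cellFourierCoeff_neg]

lemma exists_poisson {u : L2Cell n} (hu : cellMean n u = 0) :
    ∃ (ψ : L2Cell n) (w : Fin n → L2Cell n) (h : Fin n → Fin n → L2Cell n),
      (∀ i, IsPartial i ψ (w i)) ∧ (∀ i j, IsPartial j (w i) (h i j)) ∧ ∑ i, h i i = u := by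
  obtain ⟨ψ, hψ⟩ := exists_cellFourierCoeff_eq_neg_div_laplaceSymbol u
  have hbound (k) {z : ℂ} (hz : ‖z‖ ≤ laplaceSymbol k) :
      ‖z * cellFourierCoeff k ψ‖ ≤ ‖cellFourierCoeff k u‖ := by
    rw [hψ, mul_div_left_comm, norm_mul, norm_neg, norm_div,
      Complex.norm_of_nonneg (laplaceSymbol_nonneg k)]
    exact mul_le_of_le_one_right (norm_nonneg _) (div_le_one_of_le₀ hz (laplaceSymbol_nonneg k))
  choose w hw using fun i => exists_isPartial fun k => hbound k (norm_partialSymbol_le i k)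
  choose h hh using fun i j => exists_isPartial (i := j) (u := w i) (f := u) fun k => by
    rw [hw, ← mul_assoc]
    exact hbound k (norm_partialSymbol_mul_le j i k)
  refine ⟨ψ, w, h, hw, hh, eq_of_cellFourierCoeff_eq fun k => ?_⟩
  have hlaplace : cellFourierCoeff k (∑ i, h i i) =
      -(laplaceSymbol k : ℂ) * cellFourierCoeff k ψ := by
    simp only [map_sum, hh _ _ k, hw _ k, ← mul_assoc, ← Finset.sum_mul,
      sum_partialSymbol_mul_self]
  rcases eq_or_ne k 0 with rfl | hk
  · simp [hlaplace, hψ, cellFourierCoeff_zero, hu]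
  · have hne : (laplaceSymbol k : ℂ) ≠ 0 := mod_cast
      ((by positivity : (0 : ℝ) < 4 * Real.pi ^ 2).trans_le (four_pi_sq_le_laplaceSymbol hk)).ne'
    rw [hlaplace, hψ]
    field_simp

end FourierMultipliers

section Jets

/-- Indices of the components of a vector field (`inl i`) and of the entries of its Jacobian
(`inr (i, j)`). -/
abbrev JetIndex (n : ℕ) : Type := Fin n ⊕ Fin n × Fin n

/-- First order jets: a square integrable vector field together with a square integrable matrix
field in the role of its Jacobian. -/
abbrev Jet (n : ℕ) : Type := PiLp 2 fun _ : JetIndex n => L2Cell n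

/-- The space `H¹_{per,0}(Y; ℝⁿ)`, a field being identified with its jet. -/
def sobolevJets (n : ℕ) : Submodule ℝ (Jet n) where
  carrier := {x | (∀ i j, IsPartial j (x (.inl i)) (x (.inr (i, j)))) ∧
    ∀ i, cellMean n (x (.inl i)) = 0}
  add_mem' := fun {x y} hx hy => ⟨fun i j k => by
      simp only [PiLp.add_apply, map_add, hx.1 i j k, hy.1 i j k, mul_add],
    fun i => by simp only [PiLp.add_apply, map_add, hx.2 i, hy.2 i, add_zero]⟩
  zero_mem' := ⟨fun i j k => by simp, fun i => by simp⟩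
  smul_mem' := fun a x hx => ⟨fun i j k => by
      simp only [PiLp.smul_apply, map_smul, hx.1 i j k, mul_smul_comm],
    fun i => by simp only [PiLp.smul_apply, map_smul, hx.2 i, smul_zero]⟩

lemma isClosed_sobolevJets (n : ℕ) : IsClosed (sobolevJets n : Set (Jet n)) := by
  have hcont (k : Fin n → ℤ) (s : JetIndex n) :
      Continuous fun x : Jet n => cellFourierCoeff k (x s) :=
    (cellFourierCoeff k).continuous.comp (PiLp.continuous_apply 2 _ s)
  have hpartial : IsClosed {x : Jet n | ∀ i j, IsPartial j (x (.inl i)) (x (.inr (i, j)))} := by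
    simp only [IsPartial, Set.ofPred_forall]
    exact isClosed_iInter fun i => isClosed_iInter fun j => isClosed_iInter fun k =>
      isClosed_eq (hcont _ _) (continuous_const.mul (hcont _ _))
  have hmean : IsClosed {x : Jet n | ∀ i, cellMean n (x (.inl i)) = 0} := by
    simp only [Set.ofPred_forall]
    exact isClosed_iInter fun i => isClosed_eq
      ((cellMean n).continuous.comp (PiLp.continuous_apply 2 _ (Sum.inl i))) continuous_const
  exact hpartial.inter hmean

instance (n : ℕ) : CompleteSpace (sobolevJets n) :=
  (isClosed_sobolevJets n).completeSpace_coe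

/-- The divergence of a jet. -/
def jetDiv (n : ℕ) : Jet n →L[ℝ] L2Cell n := ∑ i, PiLp.proj 2 _ (.inr (i, i))

lemma jetDiv_apply (x : Jet n) : jetDiv n x = ∑ i, x (.inr (i, i)) := by
  simp [jetDiv, _root_.sum_apply]

/-- The entry `(i, j)` of `Dw - (Dw)ᵀ`, for a jet with Jacobian `Dw`. -/
def jetSkew (i j : Fin n) : Jet n →L[ℝ] L2Cell n :=
  PiLp.proj 2 _ (.inr (i, j)) - PiLp.proj 2 _ (.inr (j, i))

lemma jetSkew_apply (i j : Fin n) (x : Jet n) :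
    jetSkew i j x = x (.inr (i, j)) - x (.inr (j, i)) := by
  simp [jetSkew]

/-- The Dirichlet energy `‖Dw‖²` of a jet. -/
def dirichletEnergy (x : Jet n) : ℝ := ∑ i, ∑ j, ‖x (.inr (i, j))‖ ^ 2

lemma dirichletEnergy_nonneg (x : Jet n) : 0 ≤ dirichletEnergy x :=
  Finset.sum_nonneg fun _ _ => Finset.sum_nonneg fun _ _ => sq_nonneg _

lemma norm_jetDiv_sq {x : Jet n} (hx : x ∈ sobolevJets n) :
    ‖jetDiv n x‖ ^ 2 = ∑ i, ∑ j, ⟪x (.inr (i, j)), x (.inr (j, i))⟫_ℝ := by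
  rw [← real_inner_self_eq_norm_sq, jetDiv_apply, sum_inner]
  refine Finset.sum_congr rfl fun i _ => ?_
  rw [inner_sum]
  exact Finset.sum_congr rfl fun j _ =>
    ((hx.1 i i).inner_swap (hx.1 i j) (hx.1 j i) (hx.1 j j)).symm

lemma sum_norm_jetSkew_sq (x : Jet n) :
    ∑ i, ∑ j, ‖jetSkew i j x‖ ^ 2 =
      2 * dirichletEnergy x - 2 * ∑ i, ∑ j, ⟪x (.inr (i, j)), x (.inr (j, i))⟫_ℝ := by
  have hswap : ∑ i, ∑ j, ‖x (.inr (j, i))‖ ^ 2 = dirichletEnergy x := Finset.sum_comm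
  calc ∑ i, ∑ j, ‖jetSkew i j x‖ ^ 2
      = dirichletEnergy x - 2 * ∑ i, ∑ j, ⟪x (.inr (i, j)), x (.inr (j, i))⟫_ℝ
          + ∑ i, ∑ j, ‖x (.inr (j, i))‖ ^ 2 := by
        simp only [jetSkew_apply, norm_sub_sq_real, dirichletEnergy, Finset.mul_sum,
          Finset.sum_add_distrib, Finset.sum_sub_distrib]
    _ = _ := by rw [hswap]; ring

lemma dirichletEnergy_eq {x : Jet n} (hx : x ∈ sobolevJets n) :
    dirichletEnergy x = ‖jetDiv n x‖ ^ 2 + 1 / 2 * ∑ i, ∑ j, ‖jetSkew i j x‖ ^ 2 := by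
  rw [norm_jetDiv_sq hx, sum_norm_jetSkew_sq]
  ring

lemma norm_jetDiv_sq_le {x : Jet n} (hx : x ∈ sobolevJets n) :
    ‖jetDiv n x‖ ^ 2 ≤ dirichletEnergy x := by
  rw [dirichletEnergy_eq hx]
  exact le_add_of_nonneg_right (by positivity)

/-- The square of the norm of the inclusion of `H¹_{per,0}(Y; ℝⁿ)`, normed by `‖Dw‖`, into the
space of jets; `4π²` is the first nonzero eigenvalue of the periodic Laplacian. -/
def jetPoincareConst : ℝ := 1 + 1 / (4 * Real.pi ^ 2)

lemma jetPoincareConst_pos : 0 < jetPoincareConst := by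
  unfold jetPoincareConst
  positivity

lemma norm_sq_le_dirichletEnergy {x : Jet n} (hx : x ∈ sobolevJets n) :
    ‖x‖ ^ 2 ≤ jetPoincareConst * dirichletEnergy x := by
  have hpoincare : 4 * Real.pi ^ 2 * ∑ i, ‖x (.inl i)‖ ^ 2 ≤ dirichletEnergy x := by
    rw [Finset.mul_sum]
    exact Finset.sum_le_sum fun i _ => poincare_inequality (hx.2 i) (hx.1 i)
  rw [PiLp.norm_sq_eq_of_L2, Fintype.sum_sum_type, Fintype.sum_prod_type, jetPoincareConst,
    add_mul, one_mul, add_comm, div_mul_eq_mul_div, one_mul]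
  exact add_le_add le_rfl ((le_div_iff₀' (by positivity)).mpr hpoincare)

end Jets

section CoefficientOperators

/-- The operator `x ↦ ∑ c_s x_s` on jets, with bounded coefficients `c_s`. -/
def jetOp (c : JetIndex n → Lp ℝ ⊤ (cellMeasure n)) : Jet n →L[ℝ] L2Cell n :=
  ∑ s, ((ContinuousLinearMap.mul ℝ ℝ).holderL (cellMeasure n) ⊤ 2 2 (c s)).comp (PiLp.proj 2 _ s)

lemma coeFn_jetOp (c : JetIndex n → Lp ℝ ⊤ (cellMeasure n)) (x : Jet n) :
    jetOp c x =ᵐ[cellMeasure n] fun y => ∑ s, c s y * x s y := by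
  have happly : jetOp c x = ∑ s, (ContinuousLinearMap.mul ℝ ℝ).holder (r := 2) (c s) (x s) := by
    simp [jetOp, _root_.sum_apply]
  rw [happly]
  filter_upwards [Lp.coeFn_finsetSum Finset.univ
      fun s => (ContinuousLinearMap.mul ℝ ℝ).holder (r := 2) (c s) (x s),
    ae_all_iff.mpr fun s => (ContinuousLinearMap.mul ℝ ℝ).coeFn_holder (r := 2) (c s) (x s)]
    with y hsum hmul
  rw [hsum, Finset.sum_apply]
  exact Finset.sum_congr rfl fun s _ => hmul s

/-- The inner product of `L²(Y)` as a continuous bilinear form. -/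
def innerBilin (n : ℕ) : L2Cell n →L[ℝ] L2Cell n →L[ℝ] ℝ :=
  (isBoundedBilinearMap_inner (𝕜 := ℝ) (E := L2Cell n)).toContinuousLinearMap

/-- The bilinear form `(v, w) ↦ ∫ (∇·v) (∑ c_s w_s) + 1/2 ∫ (Dv - (Dv)ᵀ) : (Dw - (Dw)ᵀ)`. -/
def jetForm (c : JetIndex n → Lp ℝ ⊤ (cellMeasure n)) : Jet n →L[ℝ] Jet n →L[ℝ] ℝ :=
  (innerBilin n).bilinearComp (jetDiv n) (jetOp c) +
    (1 / 2 : ℝ) • ∑ i, ∑ j, (innerBilin n).bilinearComp (jetSkew i j) (jetSkew i j)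

lemma jetForm_apply (c : JetIndex n → Lp ℝ ⊤ (cellMeasure n)) (x y : Jet n) :
    jetForm c x y = ⟪jetDiv n x, jetOp c y⟫_ℝ +
      1 / 2 * ∑ i, ∑ j, ⟪jetSkew i j x, jetSkew i j y⟫_ℝ := by
  simp [jetForm, innerBilin, _root_.sum_apply]

lemma jetForm_self (c : JetIndex n → Lp ℝ ⊤ (cellMeasure n)) {x : Jet n}
    (hx : x ∈ sobolevJets n) :
    jetForm c x x = dirichletEnergy x + ⟪jetDiv n x, jetOp c x - jetDiv n x⟫_ℝ := by
  rw [jetForm_apply, dirichletEnergy_eq hx, inner_sub_right, real_inner_self_eq_norm_sq]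
  simp only [real_inner_self_eq_norm_sq]
  ring

/-- The coefficients of the divergence, as an operator on jets. -/
def divCoeff (n : ℕ) : JetIndex n → ℝ := Sum.elim 0 fun p => (1 : Matrix (Fin n) (Fin n) ℝ) p.1 p.2

/-- The squared Euclidean distance from the coefficients `c` to those of the divergence is at
most `κ` almost everywhere. -/
def IsNearDiv (κ : ℝ) (c : JetIndex n → Lp ℝ ⊤ (cellMeasure n)) : Prop :=
  ∀ᵐ y ∂(cellMeasure n), ∑ s, (c s y - divCoeff n s) ^ 2 ≤ κ

lemma coeFn_jetOp_sub_jetDiv (c : JetIndex n → Lp ℝ ⊤ (cellMeasure n)) (x : Jet n) :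
    ⇑(jetOp c x - jetDiv n x) =ᵐ[cellMeasure n] fun y => ∑ s, (c s y - divCoeff n s) * x s y := by
  rw [jetDiv_apply]
  filter_upwards [coeFn_jetOp c x, Lp.coeFn_sub (jetOp c x) (∑ i, x (.inr (i, i))),
    Lp.coeFn_finsetSum Finset.univ fun i => x (.inr (i, i))] with y hop hsub hdiv
  rw [hsub, Pi.sub_apply, hop, hdiv]
  simp [sub_mul, divCoeff, Fintype.sum_sum_type, Fintype.sum_prod_type, Matrix.one_apply]

lemma norm_sq_eq_integral (f : L2Cell n) : ‖f‖ ^ 2 = ∫ y, f y ^ 2 ∂(cellMeasure n) := by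
  rw [← real_inner_self_eq_norm_sq, L2.inner_def]
  simp [sq]

lemma IsNearDiv.norm_jetOp_sub_jetDiv_sq_le {c : JetIndex n → Lp ℝ ⊤ (cellMeasure n)} {κ : ℝ}
    (hc : IsNearDiv κ c) (x : Jet n) : ‖jetOp c x - jetDiv n x‖ ^ 2 ≤ κ * ‖x‖ ^ 2 := by
  have hint (s) : Integrable (fun y => x s y ^ 2) (cellMeasure n) := (Lp.memLp (x s)).integrable_sq
  calc ‖jetOp c x - jetDiv n x‖ ^ 2
      = ∫ y, (jetOp c x - jetDiv n x : L2Cell n) y ^ 2 ∂(cellMeasure n) := norm_sq_eq_integral _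
    _ ≤ ∫ y, κ * ∑ s, x s y ^ 2 ∂(cellMeasure n) := by
        refine integral_mono_ae (Lp.memLp _).integrable_sq
          ((integrable_finsetSum _ fun s _ => hint s).const_mul κ) ?_
        filter_upwards [hc, coeFn_jetOp_sub_jetDiv c x] with y hy hval
        rw [hval]
        exact (Finset.sum_mul_sq_le_sq_mul_sq _ _ _).trans
          (mul_le_mul_of_nonneg_right hy (Finset.sum_nonneg fun _ _ => sq_nonneg _))
    _ = κ * ‖x‖ ^ 2 := by
        rw [integral_const_mul, integral_finsetSum _ fun s _ => hint s, PiLp.norm_sq_eq_of_L2]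
        simp only [norm_sq_eq_integral]

lemma IsNearDiv.nonneg {c : JetIndex n → Lp ℝ ⊤ (cellMeasure n)} {κ : ℝ} (hc : IsNearDiv κ c) :
    0 ≤ κ :=
  let ⟨_, hy⟩ := hc.exists
  (Finset.sum_nonneg fun _ _ => sq_nonneg _).trans hy

lemma IsNearDiv.le_jetForm_self {c : JetIndex n → Lp ℝ ⊤ (cellMeasure n)} {κ : ℝ}
    (hc : IsNearDiv κ c) {x : Jet n} (hx : x ∈ sobolevJets n) :
    (1 - √(κ * jetPoincareConst)) * dirichletEnergy x ≤ jetForm c x x := by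
  set E := dirichletEnergy x
  have hE : 0 ≤ E := dirichletEnergy_nonneg x
  have hdiv : ‖jetDiv n x‖ ≤ √E := Real.le_sqrt_of_sq_le (norm_jetDiv_sq_le hx)
  have hdiff : ‖jetOp c x - jetDiv n x‖ ≤ √(κ * jetPoincareConst) * √E := by
    rw [← Real.sqrt_mul (mul_nonneg hc.nonneg jetPoincareConst_pos.le), mul_assoc]
    exact Real.le_sqrt_of_sq_le ((hc.norm_jetOp_sub_jetDiv_sq_le x).trans
      (mul_le_mul_of_nonneg_left (norm_sq_le_dirichletEnergy hx) hc.nonneg))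
  have hinner : |⟪jetDiv n x, jetOp c x - jetDiv n x⟫_ℝ| ≤ √(κ * jetPoincareConst) * E :=
    calc _ ≤ ‖jetDiv n x‖ * ‖jetOp c x - jetDiv n x‖ := abs_real_inner_le_norm _ _
      _ ≤ √E * (√(κ * jetPoincareConst) * √E) := by gcongr
      _ = √(κ * jetPoincareConst) * E := by rw [mul_left_comm, Real.mul_self_sqrt hE]
  rw [jetForm_self c hx]
  linarith [neg_le_of_abs_le hinner]

/-- Coercivity of `jetForm c` on `H¹_{per,0}(Y; ℝⁿ)`. -/
def JetCoercive (c : JetIndex n → Lp ℝ ⊤ (cellMeasure n)) : Prop :=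
  ∃ α > 0, ∀ x ∈ sobolevJets n, α * ‖x‖ ^ 2 ≤ jetForm c x x

lemma IsNearDiv.jetCoercive {c : JetIndex n → Lp ℝ ⊤ (cellMeasure n)} {κ : ℝ}
    (hc : IsNearDiv κ c) (hκ : κ * jetPoincareConst < 1) : JetCoercive c := by
  have hθ : 0 < 1 - √(κ * jetPoincareConst) := by
    rw [sub_pos, Real.sqrt_lt' one_pos]
    simpa using hκ
  refine ⟨(1 - √(κ * jetPoincareConst)) / jetPoincareConst, div_pos hθ jetPoincareConst_pos,
    fun x hx => le_trans ?_ (hc.le_jetForm_self hx)⟩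
  rw [div_mul_eq_mul_div, div_le_iff₀ jetPoincareConst_pos, mul_assoc]
  refine mul_le_mul_of_nonneg_left ?_ hθ.le
  rw [mul_comm]
  exact norm_sq_le_dirichletEnergy hx

end CoefficientOperators

section LaxMilgram

variable {V : Type*} [NormedAddCommGroup V] [InnerProductSpace ℝ V]

lemma existsUnique_of_isCoercive [CompleteSpace V] {B : V →L[ℝ] V →L[ℝ] ℝ} (hB : IsCoercive B)
    (ℓ : V →L[ℝ] ℝ) : ∃! v, ∀ w, B v w = ℓ w := by
  refine ⟨hB.continuousLinearEquivOfBilin.symm ((InnerProductSpace.toDual ℝ V).symm ℓ),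
    fun w => ?_, fun v hv => ?_⟩
  · rw [← hB.continuousLinearEquivOfBilin_apply, ContinuousLinearEquiv.apply_symm_apply,
      InnerProductSpace.toDual_symm_apply]
  · rw [ContinuousLinearEquiv.eq_symm_apply]
    refine ext_inner_right ℝ fun w => ?_
    rw [hB.continuousLinearEquivOfBilin_apply, hv, InnerProductSpace.toDual_symm_apply]

end LaxMilgram

lemma JetCoercive.existsUnique {c : JetIndex n → Lp ℝ ⊤ (cellMeasure n)} (hc : JetCoercive c)
    (ℓ : Jet n →L[ℝ] ℝ) :
    ∃! x, x ∈ sobolevJets n ∧ ∀ y ∈ sobolevJets n, jetForm c x y = ℓ y := by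
  obtain ⟨α, hα, hle⟩ := hc
  let ι := (sobolevJets n).subtypeL
  have hcoercive : IsCoercive ((jetForm c).bilinearComp ι ι) :=
    ⟨α, hα, fun x => by simpa [sq, mul_assoc, ι] using hle x x.2⟩
  obtain ⟨x, hx, huniq⟩ := existsUnique_of_isCoercive hcoercive (ℓ.comp ι)
  exact ⟨x, ⟨x.2, fun y hy => hx ⟨y, hy⟩⟩,
    fun x' hx' => congrArg Subtype.val (huniq ⟨x', hx'.1⟩ fun y => hx'.2 y y.2)⟩

section AbstractProblem

/-- Jets `(∇ψ, D²ψ)` of gradients of functions `ψ ∈ H²_per(Y)`. -/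
def IsGradJet (x : Jet n) : Prop :=
  (∃ ψ, ∀ i, IsPartial i ψ (x (.inl i))) ∧ ∀ i j, IsPartial j (x (.inl i)) (x (.inr (i, j)))

lemma IsGradJet.mem_sobolevJets {x : Jet n} (hx : IsGradJet x) : x ∈ sobolevJets n :=
  let ⟨_, hψ⟩ := hx.1
  ⟨hx.2, fun i => (hψ i).cellMean_eq_zero⟩

lemma IsGradJet.jetSkew_eq_zero {x : Jet n} (hx : IsGradJet x) (i j : Fin n) :
    jetSkew i j x = 0 := by
  obtain ⟨ψ, hψ⟩ := hx.1
  rw [jetSkew_apply, sub_eq_zero]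
  exact (hψ i).comm (hx.2 i j) (hψ j) (hx.2 j i)

lemma exists_isGradJet_jetDiv_eq {u : L2Cell n} (hu : cellMean n u = 0) :
    ∃ x, IsGradJet x ∧ jetDiv n x = u := by
  obtain ⟨ψ, w, h, hw, hh, hsum⟩ := exists_poisson hu
  refine ⟨WithLp.toLp 2 (Sum.elim w fun p => h p.1 p.2), ⟨⟨ψ, hw⟩, hh⟩, ?_⟩
  rw [jetDiv_apply, ← hsum]
  rfl

lemma cellMean_jetDiv {x : Jet n} (hx : x ∈ sobolevJets n) : cellMean n (jetDiv n x) = 0 := by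
  rw [jetDiv_apply, map_sum]
  exact Finset.sum_eq_zero fun i _ => (hx.1 i i).cellMean_eq_zero

variable {c : JetIndex n → Lp ℝ ⊤ (cellMeasure n)} {ℓ : Jet n →L[ℝ] ℝ} {u v r : L2Cell n}

lemma IsGradJet.jetForm_eq {y : Jet n} (hy : IsGradJet y) (x : Jet n) :
    jetForm c x y = ⟪jetDiv n x, jetOp c y⟫_ℝ := by
  simp [jetForm_apply, hy.jetSkew_eq_zero]

/-- The very weak formulation of `-D²:(A u) + ∇·(b u) = ℓ`, the coefficients `c` gathering the
entries of `b` and `A`, and `ℓ` being a functional of the gradient of the test function. -/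
def SolvesFPK (c : JetIndex n → Lp ℝ ⊤ (cellMeasure n)) (ℓ : Jet n →L[ℝ] ℝ) (u : L2Cell n) :
    Prop :=
  ∀ x, IsGradJet x → ⟪u, jetOp c x⟫_ℝ = ℓ x

lemma SolvesFPK.sub (hu : SolvesFPK c ℓ u) (hv : SolvesFPK c ℓ v) : SolvesFPK c 0 (u - v) :=
  fun x hx => by simp [inner_sub_left, hu x hx, hv x hx]

lemma SolvesFPK.add_smul (hu : SolvesFPK c ℓ u) (hr : SolvesFPK c 0 r) (a : ℝ) :
    SolvesFPK c ℓ (u + a • r) :=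
  fun x hx => by simp [inner_add_left, real_inner_smul_left, hu x hx, hr x hx]

lemma JetCoercive.eq_zero (hc : JetCoercive c) {x : Jet n} (hx : x ∈ sobolevJets n)
    (h : jetForm c x x = 0) : x = 0 := by
  obtain ⟨α, hα, hle⟩ := hc
  have hsq : α * ‖x‖ ^ 2 ≤ 0 := h ▸ hle x hx
  have : ‖x‖ ^ 2 = 0 := le_antisymm (nonpos_of_mul_nonpos_right hsq hα) (sq_nonneg _)
  simpa using this

lemma SolvesFPK.eq_zero (hc : JetCoercive c) (hu : SolvesFPK c 0 u) (hmean : cellMean n u = 0) :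
    u = 0 := by
  obtain ⟨x, hx, rfl⟩ := exists_isGradJet_jetDiv_eq hmean
  have hform : jetForm c x x = 0 := (hx.jetForm_eq x).trans (hu x hx)
  rw [hc.eq_zero hx.mem_sobolevJets hform, map_zero]

lemma SolvesFPK.eq_of_cellMean_eq (hc : JetCoercive c) (hu : SolvesFPK c ℓ u)
    (hv : SolvesFPK c ℓ v) (hmean : cellMean n u = cellMean n v) : u = v :=
  sub_eq_zero.mp <| (hu.sub hv).eq_zero hc <| by rw [map_sub, hmean, sub_self]

lemma SolvesFPK.iff_exists_eq_add_smul (hc : JetCoercive c) (hu : SolvesFPK c ℓ u)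
    (hr : SolvesFPK c 0 r) (hmean : cellMean n r = 1) :
    SolvesFPK c ℓ v ↔ ∃ a : ℝ, v = u + a • r := by
  refine ⟨fun hv => ⟨cellMean n v - cellMean n u, ?_⟩, ?_⟩
  · refine hv.eq_of_cellMean_eq hc (hu.add_smul hr _) ?_
    rw [map_add, map_smul, hmean, smul_eq_mul]
    ring
  · rintro ⟨a, rfl⟩
    exact hu.add_smul hr a

lemma solvesFPK_neg_jetDiv {x : Jet n} (hx : ∀ y ∈ sobolevJets n, jetForm c x y = -ℓ y) :
    SolvesFPK c ℓ (-jetDiv n x) := fun y hy => by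
  rw [inner_neg_left, ← hy.jetForm_eq, hx y hy.mem_sobolevJets, neg_neg]

/-- With `B₂(ρ, ·) = ⟪1, T ·⟫`, where `T` is the operator with coefficients `c`, the function
`1 - ∇·ρ` is orthogonal to `T ∇φ` for all `φ`. -/
lemma JetCoercive.exists_solvesFPK_zero (hc : JetCoercive c) :
    ∃ r, SolvesFPK c 0 r ∧ cellMean n r = 1 := by
  obtain ⟨x, ⟨hx, hform⟩, -⟩ := hc.existsUnique ((innerBilin n (cellOne n)).comp (jetOp c))
  refine ⟨cellOne n - jetDiv n x, fun y hy => ?_, ?_⟩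
  · rw [inner_sub_left, ← hy.jetForm_eq, hform y hy.mem_sobolevJets]
    exact sub_self _
  · rw [map_sub, cellMean_cellOne, cellMean_jetDiv hx, sub_zero]

end AbstractProblem

section Cordes

lemma frob_sub_one_self (M : Matrix (Fin n) (Fin n) ℝ) :
    frob (M - 1) (M - 1) = frob M M - 2 * M.trace + n := by
  have hentry (i j) : (M - 1) i j * (M - 1) i j =
      M i j * M i j - (if i = j then 2 * M i j else 0) + if i = j then 1 else 0 := by
    rw [Matrix.sub_apply, Matrix.one_apply]
    split_ifs <;> ring
  simp only [frob, hentry, Finset.sum_add_distrib, Finset.sum_sub_distrib, Finset.sum_ite_eq,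
    Finset.mem_univ, if_true, Finset.sum_const, Finset.card_univ, Fintype.card_fin, nsmul_eq_mul,
    mul_one, Matrix.trace, Matrix.diag_apply, Finset.mul_sum]

lemma frob_smul_smul (a : ℝ) (M : Matrix (Fin n) (Fin n) ℝ) :
    frob (a • M) (a • M) = a ^ 2 * frob M M := by
  simp only [frob, Matrix.smul_apply, smul_eq_mul, Finset.mul_sum]
  exact Finset.sum_congr rfl fun _ _ => Finset.sum_congr rfl fun _ _ => by ring

lemma frob_self_pos {M : Matrix (Fin n) (Fin n) ℝ} (hM : M.trace ≠ 0) : 0 < frob M M := by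
  obtain ⟨i, -, hi⟩ := Finset.exists_ne_zero_of_sum_ne_zero hM
  refine Finset.sum_pos' (fun _ _ => Finset.sum_nonneg fun _ _ => mul_self_nonneg _)
    ⟨i, Finset.mem_univ i, Finset.sum_pos' (fun _ _ => mul_self_nonneg _)
      ⟨i, Finset.mem_univ i, mul_self_pos.mpr hi⟩⟩

/-- The scaling by `γ = tr M / (|M|² + |v|²)` minimizes the left-hand side, with minimum
`n - (tr M)² / (|M|² + |v|²)`. -/
lemma renormalized_sub_one_le {M : Matrix (Fin n) (Fin n) ℝ} {v : Fin n → ℝ} {γ δ : ℝ}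
    (hγ : γ = M.trace / (frob M M + v ⬝ᵥ v)) (htr : M.trace ≠ 0)
    (hcordes : (frob M M + v ⬝ᵥ v) / M.trace ^ 2 ≤ 1 / ((n : ℝ) - 1 + δ)) :
    (γ • v) ⬝ᵥ (γ • v) + frob (γ • M - 1) (γ • M - 1) ≤ 1 - δ := by
  have hS : 0 < frob M M + v ⬝ᵥ v :=
    add_pos_of_pos_of_nonneg (frob_self_pos htr) (Finset.sum_nonneg fun _ _ => mul_self_nonneg _)
  have hδ : 0 < (n : ℝ) - 1 + δ := one_div_pos.mp <| lt_of_lt_of_le (by positivity) hcordes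
  have hle : (n : ℝ) - 1 + δ ≤ M.trace ^ 2 / (frob M M + v ⬝ᵥ v) := by
    rw [div_le_div_iff₀ (by positivity) hδ, one_mul] at hcordes
    rwa [le_div_iff₀' hS]
  calc (γ • v) ⬝ᵥ (γ • v) + frob (γ • M - 1) (γ • M - 1)
      = γ ^ 2 * (frob M M + v ⬝ᵥ v) - 2 * (γ * M.trace) + n := by
        rw [frob_sub_one_self, frob_smul_smul, Matrix.trace_smul, smul_dotProduct,
          dotProduct_smul]
        simp only [smul_eq_mul]
        ring
    _ = n - M.trace ^ 2 / (frob M M + v ⬝ᵥ v) := by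
        rw [hγ]
        field_simp
        ring
    _ ≤ 1 - δ := by linarith

/-- The entries of the drift `b` and of the diffusion matrix `A`, indexed by the components of a
jet. -/
def jetCoeff (A : (Fin n → ℝ) → Matrix (Fin n) (Fin n) ℝ) (b : (Fin n → ℝ) → (Fin n → ℝ)) :
    JetIndex n → (Fin n → ℝ) → ℝ :=
  Sum.elim (fun i y => b y i) fun p y => A y p.1 p.2

variable {A : (Fin n → ℝ) → Matrix (Fin n) (Fin n) ℝ} {b : (Fin n → ℝ) → (Fin n → ℝ)}

lemma sum_jetCoeff_sub_divCoeff_sq (y : Fin n → ℝ) :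
    ∑ s, (jetCoeff A b s y - divCoeff n s) ^ 2 =
      b y ⬝ᵥ b y + frob (A y - 1) (A y - 1) := by
  simp [Fintype.sum_sum_type, Fintype.sum_prod_type, jetCoeff, divCoeff, dotProduct, frob, sq]

lemma aemeasurable_gam {μ : Measure (Fin n → ℝ)} (hA : ∀ i j, AEMeasurable (fun x => A x i j) μ)
    (hb : ∀ i, AEMeasurable (fun x => b x i) μ) : AEMeasurable (gam A b) μ :=
  (Finset.aemeasurable_fun_sum _ fun i _ => hA i i).div <|
    (Finset.aemeasurable_fun_sum _ fun i _ =>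
      Finset.aemeasurable_fun_sum _ fun j _ => (hA i j).mul (hA i j)).add
    (Finset.aemeasurable_fun_sum _ fun i _ => (hb i).mul (hb i))

lemma aemeasurable_jetCoeff_renorm {μ : Measure (Fin n → ℝ)}
    (hA : ∀ i j, AEMeasurable (fun x => A x i j) μ) (hb : ∀ i, AEMeasurable (fun x => b x i) μ)
    (s : JetIndex n) : AEMeasurable (jetCoeff (renormA A b) (renormB A b) s) μ := by
  rcases s with i | ⟨i, j⟩
  · exact (aemeasurable_gam hA hb).mul (hb i)
  · exact (aemeasurable_gam hA hb).mul (hA i j)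

/-- `c` consists of the classes in `L^∞(Y)` of the entries of `b` and `A`. -/
def RepresentsCoeff (c : JetIndex n → Lp ℝ ⊤ (cellMeasure n))
    (A : (Fin n → ℝ) → Matrix (Fin n) (Fin n) ℝ) (b : (Fin n → ℝ) → (Fin n → ℝ)) : Prop :=
  ∀ s, c s =ᵐ[cellMeasure n] jetCoeff A b s

lemma exists_representsCoeff_isNearDiv {κ : ℝ}
    (hmeas : ∀ s, AEMeasurable (jetCoeff A b s) (cellMeasure n))
    (hκ : ∀ᵐ y ∂(cellMeasure n), b y ⬝ᵥ b y + frob (A y - 1) (A y - 1) ≤ κ) :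
    ∃ c, RepresentsCoeff c A b ∧ IsNearDiv κ c := by
  have hbound (s : JetIndex n) :
      ∀ᵐ y ∂(cellMeasure n), ‖jetCoeff A b s y‖ ≤ √κ + ‖divCoeff n s‖ := by
    filter_upwards [hκ] with y hy
    rw [← sum_jetCoeff_sub_divCoeff_sq] at hy
    have hs : |jetCoeff A b s y - divCoeff n s| ≤ √κ := Real.abs_le_sqrt <|
      (Finset.single_le_sum (f := fun s => (jetCoeff A b s y - divCoeff n s) ^ 2)
        (fun _ _ => sq_nonneg _) (Finset.mem_univ s)).trans hy
    exact (norm_le_norm_sub_add _ (divCoeff n s)).trans (add_le_add hs le_rfl)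
  have hmem (s) : MemLp (jetCoeff A b s) ⊤ (cellMeasure n) :=
    MemLp.of_bound (hmeas s).aestronglyMeasurable _ (hbound s)
  refine ⟨fun s => (hmem s).toLp, fun s => (hmem s).coeFn_toLp, ?_⟩
  filter_upwards [hκ, ae_all_iff.mpr fun s => (hmem s).coeFn_toLp] with y hy hcoeff
  simpa only [hcoeff, sum_jetCoeff_sub_divCoeff_sq] using hy

lemma exists_jetCoercive_of_cordes {δ : ℝ}
    (hA : ∀ i j, AEMeasurable (fun x => A x i j) (cellMeasure n))
    (hb : ∀ i, AEMeasurable (fun x => b x i) (cellMeasure n))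
    (htr : ∀ᵐ x ∂(cellMeasure n), (A x).trace ≠ 0)
    (hδ : 1 / (1 + 4 * Real.pi ^ 2) < δ)
    (hcordes : ∀ᵐ x ∂(cellMeasure n),
      (frob (A x) (A x) + b x ⬝ᵥ b x) / (A x).trace ^ 2 ≤ 1 / ((n : ℝ) - 1 + δ)) :
    ∃ c, RepresentsCoeff c (renormA A b) (renormB A b) ∧ JetCoercive c := by
  obtain ⟨c, hrep, hnear⟩ := exists_representsCoeff_isNearDiv (κ := 1 - δ)
    (aemeasurable_jetCoeff_renorm hA hb) <| by
      filter_upwards [htr, hcordes] with x htrx hcordesx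
      exact renormalized_sub_one_le rfl htrx hcordesx
  refine ⟨c, hrep, hnear.jetCoercive ?_⟩
  rw [div_lt_iff₀ (by positivity)] at hδ
  rw [jetPoincareConst, one_add_div (by positivity), mul_div_assoc', div_lt_one (by positivity)]
  linarith

end Cordes

section Representatives

lemma YPeriodic.apply_fract {α : Type*} {f : (Fin n → ℝ) → α} (hf : YPeriodic f)
    (x : Fin n → ℝ) : f (fun i => Int.fract (x i)) = f x := by
  rw [← hf _ fun i => ⌊x i⌋]
  exact congrArg f (funext fun i => Int.fract_add_floor (x i))

lemma ae_fract_mem_unitCell (n : ℕ) :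
    ∀ᵐ x : Fin n → ℝ, (fun i => Int.fract (x i)) ∈ unitCell n := by
  have hnot_int : ∀ᵐ t : ℝ, t ∉ Set.range ((↑) : ℤ → ℝ) :=
    (Set.countable_range _).ae_notMem volume
  filter_upwards [ae_all_iff.mpr fun i =>
    (Measure.quasiMeasurePreserving_eval (fun _ : Fin n => (volume : Measure ℝ)) i).ae hnot_int]
    with x hx i _
  exact ⟨Int.fract_pos.mpr fun h => hx i ⟨⌊x i⌋, h.symm⟩, Int.fract_lt_one _⟩

lemma ae_fract_of_ae_cellMeasure {p : (Fin n → ℝ) → Prop} (h : ∀ᵐ x ∂(cellMeasure n), p x) :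
    ∀ᵐ x : Fin n → ℝ, p fun i => Int.fract (x i) := by
  have hcell : ∀ᵐ x : Fin n → ℝ, x ∈ unitCell n → p x :=
    (ae_restrict_iff' (measurableSet_unitCell n)).mp h
  have htranslate : ∀ᵐ x : Fin n → ℝ, ∀ k : Fin n → ℤ,
      (x + fun i => (k i : ℝ)) ∈ unitCell n → p (x + fun i => (k i : ℝ)) :=
    ae_all_iff.mpr fun k => (measurePreserving_add_right volume
      fun i => (k i : ℝ)).quasiMeasurePreserving.ae hcell
  filter_upwards [htranslate, ae_fract_mem_unitCell n] with x hx hmem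
  have hfract : (fun i => Int.fract (x i)) = x + fun i => ((-⌊x i⌋ : ℤ) : ℝ) := by
    funext i
    simp [Int.fract, sub_eq_add_neg]
  rw [hfract] at hmem ⊢
  exact hx _ hmem

lemma YPeriodic.ae_eq {α : Type*} {f g : (Fin n → ℝ) → α} (hf : YPeriodic f) (hg : YPeriodic g)
    (h : f =ᵐ[cellMeasure n] g) : f =ᵐ[volume] g := by
  filter_upwards [ae_fract_of_ae_cellMeasure h] with x hx
  rwa [hf.apply_fract, hg.apply_fract] at hx

/-- The `Y`-periodic extension of the restriction of `f` to the cell. -/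
def perExt (f : (Fin n → ℝ) → ℝ) (x : Fin n → ℝ) : ℝ := f fun i => Int.fract (x i)

lemma yPeriodic_perExt (f : (Fin n → ℝ) → ℝ) : YPeriodic (perExt f) := fun x k => by
  simp [perExt]

lemma perExt_ae_eq (f : (Fin n → ℝ) → ℝ) : perExt f =ᵐ[cellMeasure n] f := by
  filter_upwards [ae_restrict_mem (measurableSet_unitCell n)] with x hx
  exact congrArg f <| funext fun i =>
    Int.fract_eq_self.mpr ⟨(hx i trivial).1.le, (hx i trivial).2⟩

lemma memLpPer_perExt (f : L2Cell n) : MemLpPer 2 (perExt f) :=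
  ⟨yPeriodic_perExt _, (Lp.memLp f).ae_eq (perExt_ae_eq f).symm⟩

open Classical in
/-- The class in `L²(Y)` of a function, with value `0` if it is not square integrable. -/
def toL2Cell (u : (Fin n → ℝ) → ℝ) : L2Cell n :=
  if h : MemLp u 2 (cellMeasure n) then h.toLp u else 0

variable {u v : (Fin n → ℝ) → ℝ}

lemma coeFn_toL2Cell (h : MemLp u 2 (cellMeasure n)) : toL2Cell u =ᵐ[cellMeasure n] u := by
  rw [toL2Cell, dif_pos h]
  exact h.coeFn_toLp

lemma toL2Cell_eq {f : L2Cell n} (h : f =ᵐ[cellMeasure n] u) : toL2Cell u = f :=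
  Lp.ext ((coeFn_toL2Cell ((Lp.memLp f).ae_eq h)).trans h.symm)

@[simp] lemma toL2Cell_perExt (f : L2Cell n) : toL2Cell (perExt f) = f :=
  toL2Cell_eq (perExt_ae_eq f).symm

lemma toL2Cell_zero : toL2Cell (fun _ : Fin n → ℝ => 0) = 0 :=
  toL2Cell_eq (Lp.coeFn_zero _ _ _)

lemma toL2Cell_neg (hu : MemLp u 2 (cellMeasure n)) :
    toL2Cell (fun x => -u x) = -toL2Cell u :=
  toL2Cell_eq ((Lp.coeFn_neg _).trans (coeFn_toL2Cell hu).neg)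

lemma toL2Cell_add_const_mul (hu : MemLp u 2 (cellMeasure n)) (hv : MemLp v 2 (cellMeasure n))
    (a : ℝ) : toL2Cell (fun x => u x + a * v x) = toL2Cell u + a • toL2Cell v :=
  toL2Cell_eq <| (Lp.coeFn_add _ _).trans <| (coeFn_toL2Cell hu).add <|
    (Lp.coeFn_smul _ _).trans ((coeFn_toL2Cell hv).const_smul a)

lemma cellMean_toL2Cell (hu : MemLp u 2 (cellMeasure n)) :
    cellMean n (toL2Cell u) = ∫ x in unitCell n, u x :=
  (cellMean_eq_integral _).trans (integral_congr_ae (coeFn_toL2Cell hu))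

lemma inner_toL2Cell {f : L2Cell n} (hu : MemLp u 2 (cellMeasure n))
    (hf : f =ᵐ[cellMeasure n] v) : ⟪toL2Cell u, f⟫_ℝ = ∫ x in unitCell n, u x * v x := by
  rw [L2.inner_def]
  refine integral_congr_ae ?_
  filter_upwards [coeFn_toL2Cell hu, hf] with x hux hfx
  rw [hux, hfx, RCLike.inner_apply', conj_trivial]

lemma MemLpPer.neg (hu : MemLpPer 2 u) : MemLpPer 2 fun x => -u x :=
  ⟨fun x k => congrArg Neg.neg (hu.1 x k), hu.2.neg⟩

lemma MemLpPer.add_const_mul (hu : MemLpPer 2 u) (hv : MemLpPer 2 v) (a : ℝ) :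
    MemLpPer 2 fun x => u x + a * v x :=
  ⟨fun x k => by simp only [hu.1 x k, hv.1 x k], hu.2.add (hv.2.const_mul a)⟩

lemma MemLpPer.ae_eq_iff (hu : MemLpPer 2 u) (hv : MemLpPer 2 v) :
    u =ᵐ[volume] v ↔ toL2Cell u = toL2Cell v := by
  refine ⟨fun h => toL2Cell_eq ((coeFn_toL2Cell hv.2).trans (ae_restrict_of_ae h.symm)),
    fun h => hu.1.ae_eq hv.1 ?_⟩
  exact (coeFn_toL2Cell hu.2).symm.trans (h ▸ coeFn_toL2Cell hv.2)

variable {i : Fin n}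

lemma HasL2WeakPartial.weakPartial_spec (h : HasL2WeakPartial i u) :
    MemLpPer 2 (weakPartial i u) ∧ HasWeakPartial i u (weakPartial i u) := by
  rw [weakPartial, dif_pos h]
  exact h.choose_spec

lemma memLpPer_weakPartial (i : Fin n) (u : (Fin n → ℝ) → ℝ) : MemLpPer 2 (weakPartial i u) := by
  by_cases h : HasL2WeakPartial i u
  · exact h.weakPartial_spec.1
  · rw [weakPartial, dif_neg h]
    exact ⟨fun _ _ => rfl, MemLp.zero⟩

lemma HasL2WeakPartial.isPartial (hu : MemLp u 2 (cellMeasure n)) (h : HasL2WeakPartial i u) :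
    IsPartial i (toL2Cell u) (toL2Cell (weakPartial i u)) :=
  hasWeakPartial_iff_isPartial.mp (h.weakPartial_spec.2.congr (coeFn_toL2Cell hu).symm
    (coeFn_toL2Cell h.weakPartial_spec.1.2).symm)

lemma IsPartial.hasL2WeakPartial {g : L2Cell n} (hu : MemLp u 2 (cellMeasure n))
    (h : IsPartial i (toL2Cell u) g) : HasL2WeakPartial i u :=
  ⟨perExt g, memLpPer_perExt g, (hasWeakPartial_iff_isPartial.mpr h).congr (coeFn_toL2Cell hu)
    (perExt_ae_eq g).symm⟩

lemma IsPartial.toL2Cell_weakPartial {g : L2Cell n} (hu : MemLp u 2 (cellMeasure n))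
    (h : IsPartial i (toL2Cell u) g) : toL2Cell (weakPartial i u) = g :=
  ((h.hasL2WeakPartial hu).isPartial hu).unique h

lemma MemH1Per.isPartial (h : MemH1Per u) (i : Fin n) :
    IsPartial i (toL2Cell u) (toL2Cell (weakPartial i u)) :=
  (h.2 i).isPartial h.1.2

lemma memH1Per_of_isPartial {g : Fin n → L2Cell n} (hu : MemLpPer 2 u)
    (h : ∀ i, IsPartial i (toL2Cell u) (g i)) : MemH1Per u :=
  ⟨hu, fun i => (h i).hasL2WeakPartial hu.2⟩

end Representatives

section JetsOfFields

variable {v w F : (Fin n → ℝ) → (Fin n → ℝ)}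

/-- The jet `(w, Dw)` of a vector field. -/
def toJet (w : (Fin n → ℝ) → (Fin n → ℝ)) : Jet n :=
  WithLp.toLp 2 (Sum.elim (fun i => toL2Cell fun y => w y i)
    fun p => toL2Cell (weakPartial p.2 fun y => w y p.1))

lemma toJet_inl (w : (Fin n → ℝ) → (Fin n → ℝ)) (i : Fin n) :
    toJet w (.inl i) = toL2Cell fun y => w y i := rfl

lemma coeFn_toJet_inr (w : (Fin n → ℝ) → (Fin n → ℝ)) :
    ∀ᵐ y ∂(cellMeasure n), ∀ i j, toJet w (.inr (i, j)) y = weakJac w y i j :=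
  ae_all_iff.mpr fun i => ae_all_iff.mpr fun j =>
    coeFn_toL2Cell (memLpPer_weakPartial j fun y => w y i).2

lemma MemH1PerZeroVec.toJet_mem (hw : MemH1PerZeroVec w) : toJet w ∈ sobolevJets n :=
  ⟨fun i j => (hw i).1.isPartial j, fun i => (cellMean_toL2Cell (hw i).1.1.2).trans (hw i).2⟩

lemma exists_memH1PerZeroVec_toJet_eq {x : Jet n} (hx : x ∈ sobolevJets n) :
    ∃ w, MemH1PerZeroVec w ∧ toJet w = x := by
  have hpartial (i j) : IsPartial j (toL2Cell (perExt (x (.inl i)))) (x (.inr (i, j))) := by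
    rw [toL2Cell_perExt]
    exact hx.1 i j
  have hmem (i) := memLpPer_perExt (x (.inl i))
  refine ⟨fun y i => perExt (x (.inl i)) y,
    fun i => ⟨memH1Per_of_isPartial (hmem i) (hpartial i), ?_⟩, ?_⟩
  · rw [← cellMean_toL2Cell (hmem i).2, toL2Cell_perExt, hx.2 i]
  · ext1 s
    rcases s with i | ⟨i, j⟩
    · exact toL2Cell_perExt _
    · exact (hpartial i j).toL2Cell_weakPartial (hmem i).2

lemma ae_eq_of_toJet_eq (hv : ∀ i, MemLpPer 2 fun x => v x i) (hw : ∀ i, MemLpPer 2 fun x => w x i)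
    (h : toJet v = toJet w) : v =ᵐ[volume] w := by
  filter_upwards [ae_all_iff.mpr fun i =>
    ((hv i).ae_eq_iff (hw i)).mpr (congrArg (fun x : Jet n => x (.inl i)) h)] with x hx
  exact funext hx

lemma MemH2Per.isGradJet {φ : (Fin n → ℝ) → ℝ} (hφ : MemH2Per φ) :
    IsGradJet (toJet (weakGrad φ)) :=
  ⟨⟨toL2Cell φ, hφ.1.isPartial⟩, fun i j => (hφ.2 i).isPartial j⟩

lemma exists_memH2Per_toJet_weakGrad_eq {x : Jet n} (hx : IsGradJet x) :
    ∃ φ, MemH2Per φ ∧ toJet (weakGrad φ) = x := by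
  obtain ⟨⟨ψ, hψ⟩, hhess⟩ := hx
  have hmem := memLpPer_perExt ψ
  have hgrad (i) : IsPartial i (toL2Cell (perExt ψ)) (x (.inl i)) := by
    rw [toL2Cell_perExt]
    exact hψ i
  have hgrad_eq (i) : toL2Cell (weakPartial i (perExt ψ)) = x (.inl i) :=
    (hgrad i).toL2Cell_weakPartial hmem.2
  have hpartial (i j) :
      IsPartial j (toL2Cell (weakPartial i (perExt ψ))) (x (.inr (i, j))) := by
    rw [hgrad_eq]
    exact hhess i j
  refine ⟨perExt ψ, ⟨memH1Per_of_isPartial hmem hgrad, fun i =>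
    memH1Per_of_isPartial (memLpPer_weakPartial i _) (hpartial i)⟩, ?_⟩
  ext1 s
  rcases s with i | ⟨i, j⟩
  · exact hgrad_eq i
  · exact (hpartial i j).toL2Cell_weakPartial (memLpPer_weakPartial i _).2

lemma memLpPer_weakDiv (w : (Fin n → ℝ) → (Fin n → ℝ)) : MemLpPer 2 (weakDiv w) :=
  ⟨fun x k => Finset.sum_congr rfl fun i _ => (memLpPer_weakPartial i _).1 x k,
    memLp_finsetSum _ fun i _ => (memLpPer_weakPartial i _).2⟩

lemma toL2Cell_weakDiv (w : (Fin n → ℝ) → (Fin n → ℝ)) :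
    toL2Cell (weakDiv w) = jetDiv n (toJet w) := by
  rw [jetDiv_apply]
  refine toL2Cell_eq ?_
  filter_upwards [Lp.coeFn_finsetSum Finset.univ fun i => toJet w (.inr (i, i)),
    coeFn_toJet_inr w] with y hsum hjac
  rw [hsum, Finset.sum_apply]
  exact Finset.sum_congr rfl fun i _ => hjac i i

lemma coeFn_jetSkew_toJet (w : (Fin n → ℝ) → (Fin n → ℝ)) :
    ∀ᵐ y ∂(cellMeasure n), ∀ i j,
      jetSkew i j (toJet w) y = (weakJac w y - (weakJac w y)ᵀ) i j := by
  simp only [ae_all_iff, jetSkew_apply]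
  intro i j
  filter_upwards [Lp.coeFn_sub (toJet w (.inr (i, j))) (toJet w (.inr (j, i))),
    coeFn_toJet_inr w] with y hsub hjac
  rw [hsub, Pi.sub_apply, hjac, hjac, Matrix.sub_apply, Matrix.transpose_apply]

lemma sum_inner_jetSkew_toJet (v w : (Fin n → ℝ) → (Fin n → ℝ)) :
    ∑ i, ∑ j, ⟪jetSkew i j (toJet v), jetSkew i j (toJet w)⟫_ℝ =
      ∫ x in unitCell n, frob (weakJac v x - (weakJac v x)ᵀ) (weakJac w x - (weakJac w x)ᵀ) := by
  have hint (i j) : Integrable (fun y => ⟪jetSkew i j (toJet v) y, jetSkew i j (toJet w) y⟫_ℝ)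
      (cellMeasure n) := L2.integrable_inner _ _
  simp only [L2.inner_def, ← integral_finsetSum _ fun j _ => hint _ j]
  rw [← integral_finsetSum _ fun i _ => integrable_finsetSum _ fun j _ => hint i j]
  refine integral_congr_ae ?_
  filter_upwards [coeFn_jetSkew_toJet v, coeFn_jetSkew_toJet w] with y hv hw
  simp only [hv, hw, frob, RCLike.inner_apply', conj_trivial]

/-- The functional `w ↦ ∫_Y F · w`, evaluated on the jet of `w`. -/
def jetPairing (F : (Fin n → ℝ) → (Fin n → ℝ)) : Jet n →L[ℝ] ℝ :=
  ∑ i, (innerBilin n (toL2Cell fun y => F y i)).comp (PiLp.proj 2 _ (.inl i))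

lemma jetPairing_apply (F : (Fin n → ℝ) → (Fin n → ℝ)) (x : Jet n) :
    jetPairing F x = ∑ i, ⟪toL2Cell fun y => F y i, x (.inl i)⟫_ℝ := by
  simp [jetPairing, innerBilin, _root_.sum_apply]

lemma jetPairing_zero : jetPairing (0 : (Fin n → ℝ) → (Fin n → ℝ)) = 0 := by
  ext x
  simp [jetPairing_apply, toL2Cell_zero]

lemma jetPairing_toJet (hF : ∀ i, MemLp (fun x => F x i) 2 (cellMeasure n))
    (hw : ∀ i, MemLp (fun x => w x i) 2 (cellMeasure n)) :
    jetPairing F (toJet w) = ∫ x in unitCell n, F x ⬝ᵥ w x := by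
  simp only [jetPairing_apply, toJet_inl, inner_toL2Cell (hF _) (coeFn_toL2Cell (hw _))]
  exact (integral_finsetSum _ fun i _ => (hF i).integrable_mul (hw i)).symm

end JetsOfFields

section WeakFormulations

variable {c : JetIndex n → Lp ℝ ⊤ (cellMeasure n)}
  {A : (Fin n → ℝ) → Matrix (Fin n) (Fin n) ℝ} {b F v w ρ : (Fin n → ℝ) → (Fin n → ℝ)}
  {u r φ : (Fin n → ℝ) → ℝ}

lemma RepresentsCoeff.memLp (hc : RepresentsCoeff c A b) (s : JetIndex n) :
    MemLp (jetCoeff A b s) ⊤ (cellMeasure n) :=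
  (Lp.memLp (c s)).ae_eq (hc s)

lemma RepresentsCoeff.coeFn_jetOp_toJet (hc : RepresentsCoeff c A b)
    (hw : ∀ i, MemLp (fun x => w x i) 2 (cellMeasure n)) :
    jetOp c (toJet w) =ᵐ[cellMeasure n] fun y => frob (A y) (weakJac w y) + b y ⬝ᵥ w y := by
  filter_upwards [coeFn_jetOp c (toJet w), ae_all_iff.mpr hc, coeFn_toJet_inr w,
    ae_all_iff.mpr fun i => coeFn_toL2Cell (hw i)] with y hop hcoeff hjac hval
  rw [hop, Fintype.sum_sum_type, Fintype.sum_prod_type, add_comm]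
  simp only [toJet_inl, hcoeff, hval, hjac, jetCoeff, Sum.elim_inl, Sum.elim_inr, frob, dotProduct]

lemma RepresentsCoeff.inner_jetOp_weakGrad (hc : RepresentsCoeff c A b)
    (hu : MemLp u 2 (cellMeasure n)) :
    ⟪toL2Cell u, jetOp c (toJet (weakGrad φ))⟫_ℝ =
      (∫ x in unitCell n, u x * frob (A x) (weakHess φ x)) +
        ∫ x in unitCell n, u x * (b x ⬝ᵥ weakGrad φ x) := by
  have hgrad (i) : MemLp (weakPartial i φ) 2 (cellMeasure n) := (memLpPer_weakPartial i φ).2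
  have hhess (i j) : MemLp (weakPartial j (weakPartial i φ)) 2 (cellMeasure n) :=
    (memLpPer_weakPartial j _).2
  have hint_A : Integrable (fun x => u x * frob (A x) (weakHess φ x)) (cellMeasure n) :=
    hu.integrable_mul (q := 2) <| memLp_finsetSum _ fun i _ => memLp_finsetSum _ fun j _ =>
      (hhess i j).mul (p := ⊤) (hc.memLp (.inr (i, j)))
  have hint_b : Integrable (fun x => u x * (b x ⬝ᵥ weakGrad φ x)) (cellMeasure n) :=
    hu.integrable_mul (q := 2) <| memLp_finsetSum _ fun i _ =>
      (hgrad i).mul (p := ⊤) (hc.memLp (.inl i))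
  rw [inner_toL2Cell hu (hc.coeFn_jetOp_toJet (w := weakGrad φ) hgrad),
    ← integral_add hint_A hint_b]
  simp only [mul_add]
  rfl

lemma RepresentsCoeff.B2_eq_jetForm (hc : RepresentsCoeff c (renormA A b) (renormB A b))
    (hw : ∀ i, MemLp (fun x => w x i) 2 (cellMeasure n)) :
    B2 A b v w = jetForm c (toJet v) (toJet w) := by
  rw [jetForm_apply, sum_inner_jetSkew_toJet, ← toL2Cell_weakDiv,
    inner_toL2Cell (memLpPer_weakDiv v).2 (hc.coeFn_jetOp_toJet hw), B2]

lemma RepresentsCoeff.isFPKSolution_iff (hc : RepresentsCoeff c A b)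
    (hF : ∀ i, MemLp (fun x => F x i) 2 (cellMeasure n)) :
    IsFPKSolution A b F u ↔ MemLpPer 2 u ∧ SolvesFPK c (jetPairing F) (toL2Cell u) := by
  refine and_congr_right fun hu => ?_
  have hequation (φ : (Fin n → ℝ) → ℝ) := hc.inner_jetOp_weakGrad (φ := φ) hu.2
  have hpairing (φ : (Fin n → ℝ) → ℝ) :=
    jetPairing_toJet (w := weakGrad φ) hF fun i => (memLpPer_weakPartial i φ).2
  simp only [← hequation, ← hpairing]
  refine ⟨fun h x hx => ?_, fun h φ hφ => h _ hφ.isGradJet⟩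
  obtain ⟨φ, hφ, rfl⟩ := exists_memH2Per_toJet_weakGrad_eq hx
  exact h φ hφ

lemma RepresentsCoeff.isRenormInvariant_iff
    (hc : RepresentsCoeff c (renormA A b) (renormB A b)) :
    IsRenormInvariant A b r ↔
      MemLpPer 2 r ∧ SolvesFPK c 0 (toL2Cell r) ∧ cellMean n (toL2Cell r) = 1 := by
  rw [IsRenormInvariant, hc.isFPKSolution_iff (F := 0) fun _ => MemLp.zero, jetPairing_zero,
    and_assoc]
  refine and_congr_right fun hr => ?_
  rw [cellMean_toL2Cell hr.2]

lemma RepresentsCoeff.isAuxSolution_iff (hc : RepresentsCoeff c (renormA A b) (renormB A b))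
    (hF : ∀ i, MemLp (fun x => F x i) 2 (cellMeasure n)) :
    IsAuxSolution A b F ρ ↔
      MemH1PerZeroVec ρ ∧ ∀ y ∈ sobolevJets n, jetForm c (toJet ρ) y = -jetPairing F y := by
  refine and_congr_right fun _ => ⟨fun h y hy => ?_, fun h w hw => ?_⟩
  · obtain ⟨w, hw, rfl⟩ := exists_memH1PerZeroVec_toJet_eq hy
    have hw₂ (i) := (hw i).1.1.2
    rw [← hc.B2_eq_jetForm hw₂, jetPairing_toJet hF hw₂, h w hw]
  · have hw₂ (i) := (hw i).1.1.2
    rw [hc.B2_eq_jetForm hw₂, ← jetPairing_toJet hF hw₂, h _ hw.toJet_mem]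

end WeakFormulations

section WellPosedness

variable {c : JetIndex n → Lp ℝ ⊤ (cellMeasure n)}
  {A : (Fin n → ℝ) → Matrix (Fin n) (Fin n) ℝ} {b F ρ ρ' : (Fin n → ℝ) → (Fin n → ℝ)}
  {u u' r : (Fin n → ℝ) → ℝ}

lemma JetCoercive.ae_eq_of_integral_eq (hcoercive : JetCoercive c) (hc : RepresentsCoeff c A b)
    (hF : ∀ i, MemLp (fun x => F x i) 2 (cellMeasure n)) (hu : IsFPKSolution A b F u)
    (hu' : IsFPKSolution A b F u')
    (hmean : ∫ x in unitCell n, u x = ∫ x in unitCell n, u' x) : u =ᵐ[volume] u' := by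
  rw [hu.1.ae_eq_iff hu'.1]
  refine ((hc.isFPKSolution_iff hF).mp hu).2.eq_of_cellMean_eq hcoercive
    ((hc.isFPKSolution_iff hF).mp hu').2 ?_
  rwa [cellMean_toL2Cell hu.1.2, cellMean_toL2Cell hu'.1.2]

lemma JetCoercive.isFPKSolution_iff_exists_const (hcoercive : JetCoercive c)
    (hc : RepresentsCoeff c (renormA A b) (renormB A b))
    (hF : ∀ i, MemLp (fun x => F x i) 2 (cellMeasure n))
    (hu' : IsFPKSolution (renormA A b) (renormB A b) F u') (hr : IsRenormInvariant A b r)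
    (hu : MemLpPer 2 u) :
    IsFPKSolution (renormA A b) (renormB A b) F u ↔
      ∃ a : ℝ, u =ᵐ[volume] fun x => u' x + a * r x := by
  obtain ⟨hr₂, hr_solves, hr_mean⟩ := hc.isRenormInvariant_iff.mp hr
  rw [hc.isFPKSolution_iff hF, and_iff_right hu,
    ((hc.isFPKSolution_iff hF).mp hu').2.iff_exists_eq_add_smul hcoercive hr_solves hr_mean]
  refine exists_congr fun a => ?_
  rw [hu.ae_eq_iff (hu'.1.add_const_mul hr₂ a), toL2Cell_add_const_mul hu'.1.2 hr₂.2]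

lemma JetCoercive.exists_isRenormInvariant (hcoercive : JetCoercive c)
    (hc : RepresentsCoeff c (renormA A b) (renormB A b)) : ∃ r, IsRenormInvariant A b r := by
  obtain ⟨r, hr, hmean⟩ := hcoercive.exists_solvesFPK_zero
  exact ⟨perExt r, hc.isRenormInvariant_iff.mpr
    ⟨memLpPer_perExt r, by rwa [toL2Cell_perExt], by rwa [toL2Cell_perExt]⟩⟩

lemma JetCoercive.exists_isAuxSolution (hcoercive : JetCoercive c)
    (hc : RepresentsCoeff c (renormA A b) (renormB A b))
    (hF : ∀ i, MemLp (fun x => F x i) 2 (cellMeasure n)) : ∃ ρ, IsAuxSolution A b F ρ := by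
  obtain ⟨x, ⟨hx, hform⟩, -⟩ := hcoercive.existsUnique (-jetPairing F)
  obtain ⟨ρ, hρ, rfl⟩ := exists_memH1PerZeroVec_toJet_eq hx
  exact ⟨ρ, (hc.isAuxSolution_iff hF).mpr ⟨hρ, hform⟩⟩

lemma JetCoercive.isAuxSolution_ae_eq (hcoercive : JetCoercive c)
    (hc : RepresentsCoeff c (renormA A b) (renormB A b))
    (hF : ∀ i, MemLp (fun x => F x i) 2 (cellMeasure n)) (hρ : IsAuxSolution A b F ρ)
    (hρ' : IsAuxSolution A b F ρ') : ρ =ᵐ[volume] ρ' := by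
  rw [hc.isAuxSolution_iff hF] at hρ hρ'
  exact ae_eq_of_toJet_eq (fun i => (hρ.1 i).1.1) (fun i => (hρ'.1 i).1.1) <|
    (hcoercive.existsUnique (-jetPairing F)).unique ⟨hρ.1.toJet_mem, hρ.2⟩ ⟨hρ'.1.toJet_mem, hρ'.2⟩

lemma toL2Cell_neg_weakDiv (ρ : (Fin n → ℝ) → (Fin n → ℝ)) :
    toL2Cell (fun x => -weakDiv ρ x) = -jetDiv n (toJet ρ) := by
  rw [toL2Cell_neg (memLpPer_weakDiv ρ).2, toL2Cell_weakDiv]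

lemma RepresentsCoeff.isFPKSolution_neg_weakDiv
    (hc : RepresentsCoeff c (renormA A b) (renormB A b))
    (hF : ∀ i, MemLp (fun x => F x i) 2 (cellMeasure n)) (hρ : IsAuxSolution A b F ρ) :
    IsFPKSolution (renormA A b) (renormB A b) F fun x => -weakDiv ρ x := by
  refine (hc.isFPKSolution_iff hF).mpr ⟨(memLpPer_weakDiv ρ).neg, ?_⟩
  rw [toL2Cell_neg_weakDiv]
  exact solvesFPK_neg_jetDiv ((hc.isAuxSolution_iff hF).mp hρ).2

lemma MemH1PerZeroVec.integral_neg_weakDiv (hρ : MemH1PerZeroVec ρ) :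
    ∫ x in unitCell n, -weakDiv ρ x = 0 := by
  rw [← cellMean_toL2Cell (memLpPer_weakDiv ρ).neg.2, toL2Cell_neg_weakDiv, map_neg,
    cellMean_jetDiv hρ.toJet_mem, neg_zero]

end WellPosedness

section Setting

variable {A : (Fin n → ℝ) → Matrix (Fin n) (Fin n) ℝ} {b : (Fin n → ℝ) → (Fin n → ℝ)}

lemma SettingB.trace_pos (hAB : SettingB A b) (hn : 1 ≤ n) : ∀ᵐ x, 0 < (A x).trace := by
  obtain ⟨lam, _, hlam, -, helliptic⟩ := hAB.elliptic
  filter_upwards [helliptic] with x hx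
  have hdiag (i) : lam ≤ A x i i := by
    simpa using (hx (Pi.single i 1)).1
  exact Finset.sum_pos (fun i _ => hlam.trans_le (hdiag i)) ⟨⟨0, hn⟩, Finset.mem_univ _⟩

/-- The bound `n / (n + π²)` comes from the Poincaré constant `diam(Y)² / π² = n / π²`, the bound
`1 / (1 + 4π²)` from the optimal constant `1 / (4π²)` on the torus. -/
lemma one_div_one_add_four_pi_sq_lt {δ : ℝ} (hn : 1 ≤ n) (hδ : (n : ℝ) / (n + Real.pi ^ 2) < δ) :
    1 / (1 + 4 * Real.pi ^ 2) < δ := by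
  have hn' : (1 : ℝ) ≤ n := by exact_mod_cast hn
  refine lt_of_le_of_lt ?_ hδ
  rw [div_le_div_iff₀ (by positivity) (by positivity)]
  nlinarith [sq_nonneg Real.pi]

end Setting

end

end CordesFPK

theorem theorem3p3_general {n : ℕ}
    (A : (Fin n → ℝ) → Matrix (Fin n) (Fin n) ℝ) (b F : (Fin n → ℝ) → (Fin n → ℝ))
    (hA : ∀ i j, AEMeasurable (fun x => A x i j) (cellMeasure n))
    (hb : ∀ i, AEMeasurable (fun x => b x i) (cellMeasure n))
    (htr : ∀ᵐ x ∂(cellMeasure n), (A x).trace ≠ 0)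
    {δ : ℝ} (hδ : 1 / (1 + 4 * Real.pi ^ 2) < δ)
    (hcordes : ∀ᵐ x ∂(cellMeasure n),
      (frob (A x) (A x) + b x ⬝ᵥ b x) / (A x).trace ^ 2 ≤ 1 / ((n : ℝ) - 1 + δ))
    (hF : ∀ i, MemLp (fun x => F x i) 2 (cellMeasure n)) :
    (∃ r, IsRenormInvariant A b r ∧ ∀ r', IsRenormInvariant A b r' → r' =ᵐ[volume] r) ∧
    (∃ ρ, IsAuxSolution A b F ρ ∧ ∀ ρ', IsAuxSolution A b F ρ' → ρ' =ᵐ[volume] ρ) ∧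
    ∀ r ρ, IsRenormInvariant A b r → IsAuxSolution A b F ρ →
      ((IsFPKSolution (renormA A b) (renormB A b) F (fun x => - weakDiv ρ x) ∧
          ∫ x in unitCell n, - weakDiv ρ x = 0) ∧
        ∀ u, IsFPKSolution (renormA A b) (renormB A b) F u → ∫ x in unitCell n, u x = 0 →
          u =ᵐ[volume] fun x => - weakDiv ρ x) ∧
      (∀ u, MemLpPer 2 u →
        (IsFPKSolution (renormA A b) (renormB A b) F u ↔
          ∃ c : ℝ, u =ᵐ[volume] fun x => - weakDiv ρ x + c * r x)) := by
  obtain ⟨c, hc, hcoercive⟩ := exists_jetCoercive_of_cordes hA hb htr hδ hcordes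
  obtain ⟨r₀, hr₀⟩ := hcoercive.exists_isRenormInvariant hc
  obtain ⟨ρ₀, hρ₀⟩ := hcoercive.exists_isAuxSolution hc hF
  refine ⟨⟨r₀, hr₀, fun r' hr' => ?_⟩,
    ⟨ρ₀, hρ₀, fun ρ' hρ' => hcoercive.isAuxSolution_ae_eq hc hF hρ' hρ₀⟩, fun r ρ hr hρ => ?_⟩
  · exact hcoercive.ae_eq_of_integral_eq hc (F := 0) (fun _ => MemLp.zero) hr'.1 hr₀.1
      (hr'.2.trans hr₀.2.symm)
  · have hsol := hc.isFPKSolution_neg_weakDiv hF hρ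
    have hmean := hρ.1.integral_neg_weakDiv
    exact ⟨⟨⟨hsol, hmean⟩, fun u hu hu₀ =>
        hcoercive.ae_eq_of_integral_eq hc hF hu hsol (hu₀.trans hmean.symm)⟩,
      fun u hu => hcoercive.isFPKSolution_iff_exists_const hc hF hsol hr hu⟩

theorem theorem3p3 {n : ℕ} (hn : 1 ≤ n)
    (A : (Fin n → ℝ) → Matrix (Fin n) (Fin n) ℝ) (b F : (Fin n → ℝ) → (Fin n → ℝ))
    (hAB : SettingB A b) (hF : MemL2PerVec F) :
    -- the problem that defines the reference function has a unique solution in `L^2_per(Y)`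
    (∃ r, IsRenormInvariant A b r ∧ ∀ r', IsRenormInvariant A b r' → r' =ᵐ[volume] r) ∧
    -- (i)
    (∃ ρ, IsAuxSolution A b F ρ ∧ ∀ ρ', IsAuxSolution A b F ρ' → ρ' =ᵐ[volume] ρ) ∧
    ∀ r ρ, IsRenormInvariant A b r → IsAuxSolution A b F ρ →
      -- (ii)
      ((IsFPKSolution (renormA A b) (renormB A b) F (fun x => - weakDiv ρ x) ∧
          ∫ x in unitCell n, - weakDiv ρ x = 0) ∧
        ∀ u, IsFPKSolution (renormA A b) (renormB A b) F u → ∫ x in unitCell n, u x = 0 →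
          u =ᵐ[volume] fun x => - weakDiv ρ x) ∧
      -- (iii)
      (∀ u, MemLpPer 2 u →
        (IsFPKSolution (renormA A b) (renormB A b) F u ↔
          ∃ c : ℝ, u =ᵐ[volume] fun x => - weakDiv ρ x + c * r x)) := by
  obtain ⟨δ, hδ, -, hcordes⟩ := hAB.cordes
  exact theorem3p3_general A b F
    (fun i j => (hAB.bounded_A i j).2.aestronglyMeasurable.aemeasurable)
    (fun i => (hAB.bounded_b i).2.aestronglyMeasurable.aemeasurable)
    (ae_restrict_of_ae ((hAB.trace_pos hn).mono fun _ h => h.ne'))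
    (one_div_one_add_four_pi_sq_lt hn hδ) (ae_restrict_of_ae hcordes) fun i => (hF i).2
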